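/- Let $A=(a_{ij})$ be a skew-symmetric $n\times n$ complex matrix all of whose columns (equivalently rows) sum to zero, and let $G$ be the graph on $V=\{1,\dots,n\}$ in which $i$ and $j$ are joined iff $a_{ij}\neq 0$. Let $\psi$ be a connection on the trivial $\mathbb{C}$-bundle over $G$: a non-zero complex number $\psi_{ij}$ for each oriented edge $(i,j)$ of $G$, with $\psi_{ij}=\psi_{ji}^{-1}$. Put $A^\psi=(a_{ij}\psi_{ij})$ (with entry $0$ where $a_{ij}=0$). For an oriented cycle $C$ of $G$ let $\omega_C=\prod_{e\in C}\psi_e$ be its monodromy. A cycle-rooted spanning forest (CRSF) of $G$ is an oriented edge configuration covering all vertices, each connected component of which consists of one cycle of length at least $3$, oriented in one of its two directions, together with trees attached to it (the branches), whose edges are oriented towards the cycle; equivalently, every vertex has exactly one outgoing edge and there is no cycle of length $2$. Apply the following algorithm to a CRSF $F$. Set $F_1=F$. As long as $F_i$ is neither empty nor made of cycles only, let $\ell$ be the largest leaf of $F_i$ (a leaf is a vertex with an outgoing but no incoming edge in $F_i$), follow the oriented edges of $F_i$ from $\ell$ until the first time that one reaches a vertex (other than the starting point) which lies on a cycle, or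 has more than one incoming edge in $F_i$, or is smaller than $\ell$; remove the edges of the path so obtained from $F_i$ to get $F_{i+1}$. Then $F$ satisfies Condition (C) if every path obtained in this way has even length. This does not depend on the orientation of the cycles of $F$. Let $\mathcal G$ be the set of CRSFs of $G$ satisfying Condition (C), where CRSFs that differ only by the orientation of their cycles are identified, and for each element of $\mathcal G$ choose an orientation of its cycles arbitrarily. Then $$\det(A^\psi)=\sum_{F\in\mathcal G}\Bigl(\prod_{e\in\mathrm{branch}(F)}a_e\Bigr)\prod_{\substack{C\text{ cycle of }F\\ |C|\text{ odd}}}\Bigl(\bigl[\omega_C-\omega_C^{-1}\bigr]\prod_{e\in C}a_e\Bigr)\prod_{\substack{C\text{ cycle of }F\\ |C|\text{ even}}}\Bigl(\bigl[2-\omega_C-\omega_C^{-1}\bigr]\prod_{e\in C}a_e\Bigr),$$ where $\mathrm{branch}(F)$ is the set of edges of $F$ not on its cycles and $a_e=a_{ij}$ for $e=(i,j)$. -/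

import Mathlib

open scoped BigOperators

namespace LineBundle

variable {V : Type*}

/-- The graph of a (skew-symmetric) matrix `A`: `i` and `j` are joined iff `a_{ij} ≠ 0`.
(For skew-symmetric `A` the symmetrisation made by `SimpleGraph.fromRel` changes nothing.) -/
def graphOf (A : Matrix V V ℂ) : SimpleGraph V :=
  SimpleGraph.fromRel (fun i j => A i j ≠ 0)

/-- A connection on the trivial `ℂ`-bundle over the graph `G`: a non-zero complex number
`ψ_{ij}` for every oriented edge `(i, j)`, with `ψ_{ij} = ψ_{ji}⁻¹`.
The values at pairs that are not edges are irrelevant and unconstrained. -/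
structure Connection (G : SimpleGraph V) where
  transport : V → V → ℂˣ
  transport_symm : ∀ i j, G.Adj i j → transport i j = (transport j i)⁻¹

/-- The matrix `A^ψ = (a_{ij} ψ_{ij})`. -/
def twist (A : Matrix V V ℂ) (ψ : Connection (graphOf A)) : Matrix V V ℂ :=
  Matrix.of fun i j => A i j * (ψ.transport i j : ℂ)

/-- Cycle-rooted spanning forests of `G`, all cycles having length at least `3`.

An oriented edge configuration with exactly one outgoing edge at every vertex is recorded by
the map `f` sending every vertex `v` to the end of its outgoing edge `(v, f v)`. When `V` is
finite these are the configurations in which each connected component consists of one oriented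
cycle (made of periodic points of `f`) with trees attached to it, whose edges are oriented
towards the cycle. There are no cycles of length `1`, since `G` has no loops;
the second condition says that there are none of length `2`. -/
def IsCRSF (G : SimpleGraph V) (f : V → V) : Prop :=
  (∀ v, G.Adj v (f v)) ∧ ∀ v, f (f v) ≠ v

section

variable [Fintype V] [LinearOrder V]

/-- The vertices lying on the cycles of the configuration. -/
noncomputable def cycleVertices (f : V → V) : Finset V :=
  (Function.periodicPts f).toFinite.toFinset

/-- The vertex set of the cycle through the vertex `v` (for `v` on a cycle): `v, f v, f (f v), …`.
The oriented edges of the cycle are the `(w, f w)` with `w` in this set, and its length is the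
cardinality of this set. -/
noncomputable def cycleThrough (f : V → V) (v : V) : Finset V :=
  (Finset.range (Function.minimalPeriod f v)).image (fun k => f^[k] v)

/-- The set of cycles of the configuration. -/
noncomputable def cycles (f : V → V) : Finset (Finset V) :=
  (cycleVertices f).image (cycleThrough f)

/-- The set of unoriented edges of the configuration. Two cycle-rooted spanning forests have the
same unoriented edges iff they differ by reversing some of the cycles. -/
def unoriented (f : V → V) : Finset (Sym2 V) :=
  Finset.univ.image (fun v => s(v, f v))

/-! ### The partial reverse algorithm

During the algorithm the current configuration `F_i` is `{(v, f v) : v ∈ S}` for a set `S` of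
vertices. -/

/-- The vertices `u` such that `(u, f u)` is an edge of the current configuration entering `v`. -/
def incoming (f : V → V) (S : Finset V) (v : V) : Finset V :=
  S.filter (fun u => f u = v)

/-- The leaves of the current configuration: vertices with no incoming edge. -/
def leaves (f : V → V) (S : Finset V) : Finset V :=
  S.filter (fun v => incoming f S v = ∅)

/-- The path which starts at the leaf `l` stops at `w` if `w` is on a cycle, or is a fork
(has more than one incoming edge in the current configuration), or is smaller than `l`. -/
def IsStop (f : V → V) (S : Finset V) (l w : V) : Prop :=
  w ∈ cycleVertices f ∨ 1 < (incoming f S w).card ∨ w < l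

/-- The length (number of edges) of the path starting at `l`: it ends the first time, after its
start, that a stopping vertex is reached. -/
noncomputable def pathLength (f : V → V) (S : Finset V) (l : V) : ℕ :=
  sInf {k : ℕ | 1 ≤ k ∧ IsStop f S l (f^[k] l)}

/-- The starting points of the edges of the path which starts at `l`. -/
noncomputable def pathSources (f : V → V) (S : Finset V) (l : V) : Finset V :=
  (Finset.range (pathLength f S l)).image (fun k => f^[k] l)

/-- One step of the algorithm: the path starting at the largest leaf is removed. If there is no
leaf (the configuration is empty or consists of cycles only) nothing is done any more. -/
noncomputable def step (f : V → V) (S : Finset V) : Finset V :=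
  if h : (leaves f S).Nonempty then S \ pathSources f S ((leaves f S).max' h) else S

/-- Condition (C): every path produced by the partial reverse algorithm, started from the whole
configuration, has even length. -/
def ConditionC (f : V → V) : Prop :=
  ∀ (i : ℕ) (h : (leaves f ((step f)^[i] Finset.univ)).Nonempty),
    Even (pathLength f ((step f)^[i] Finset.univ)
      ((leaves f ((step f)^[i] Finset.univ)).max' h))

open Classical in
/-- The set of cycle-rooted spanning forests of `G` satisfying Condition (C), where forests that
differ only in the orientation of their cycles are identified: each of them is recorded by its
set of unoriented edges. -/
noncomputable def forestsC (G : SimpleGraph V) : Finset (Finset (Sym2 V)) :=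
  (Finset.univ.filter (fun f : V → V => IsCRSF G f ∧ ConditionC f)).image unoriented

/-- The product `∏ a_e` over the oriented edges of the cycle `C` of the configuration `f`. -/
def cycleWeight (A : Matrix V V ℂ) (f : V → V) (C : Finset V) : ℂ :=
  ∏ v ∈ C, A v (f v)

/-- The monodromy `ω` around the oriented cycle `C` of the configuration `f`. -/
def monodromy {G : SimpleGraph V} (ψ : Connection G) (f : V → V) (C : Finset V) : ℂ :=
  ∏ v ∈ C, (ψ.transport v (f v) : ℂ)

/-- The product `∏ a_e` over the oriented edges of the branches. -/
noncomputable def branchWeight (A : Matrix V V ℂ) (f : V → V) : ℂ :=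
  ∏ v ∈ (cycleVertices f)ᶜ, A v (f v)

end

end LineBundle

/-!
The determinant is computed by exploring configurations.

*The determinant.* In the expansion of `det A^ψ` over permutations without fixed points, separate
the cycles of length two from the permutation `τ` formed by the longer cycles. The connection
cancels on cycles of length two, so that `det A^ψ` is the sum over `τ` of its signed weight times
the sum `matchingSum` of the weights of the perfect matchings of the complement `Kᶜ` of
`K = supp τ` (`det_twist_eq_sum`).

*From matchings to branches.* The sum over matchings is turned into a sum over configurations
`f` on `Kᶜ` (`explorationSum_eq_matchingSum`). Starting from the smallest vertex `r` outside `K`,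
expand along the partner `u` of `r`, with weight `a_{ru}²`. As the rows of `A` sum to zero and `A`
is skew-symmetric, one factor `a_{ru}` is `∑_{w ≠ r} a_{uw}`; this is the choice of a successor `w`
of `u` which creates no cycle of length two. If `w` is not yet visited, continue from `w`, otherwise
restart from the smallest unvisited vertex. The configurations obtained are those for which every
exploration visits an even number of new vertices. A vertex `v` is visited by the exploration which
starts at the smallest vertex whose orbit contains `v`, its *minimal source*; hence these are the
configurations in which the *blocks* of vertices outside `K` with a given minimal source are even
(`EvenBlocks`).

*Condition (C).* The partial reverse algorithm removes the blocks of the branches one after the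
other, in decreasing order of the minimal source, so that Condition (C) says that the blocks outside
all cycles are even (`conditionC_iff_evenBlocks`). A cycle is contained in a single block, so
it does not matter whether an even cycle is counted.

*Orientations.* Thus `det A^ψ` is a sum over configurations `f` together with a set `E` of
cycles of `f`, which carry their monodromy and their signature
(`det_twist_eq_sum_configurations`). Reversing cycles changes neither reachability nor the blocks.
Summing over the orientations, a cycle in `E` contributes `ω - ω⁻¹` or `-(ω + ω⁻¹)` according to the
parity of its length, and a cycle outside `E` contributes `0` if it is odd and `2` if it is even
(`sum_reverseCycles`). As odd cycles outside `E` cancel, only forests with Condition (C) remain,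
and summing over `E` gives the product of the factors of the cycles (`sum_fiber_eq`).
-/

namespace LineBundle

/-! ### Reachability and minimal sources -/

section

variable {V : Type*}

/-- The vertex `v` lies on the forward orbit of `u`. -/
def Reach (f : V → V) (u v : V) : Prop := ∃ k, f^[k] u = v

theorem Reach.refl (f : V → V) (u : V) : Reach f u u := ⟨0, rfl⟩

theorem Reach.trans {f : V → V} {u v w : V} (h₁ : Reach f u v) (h₂ : Reach f v w) :
    Reach f u w := by
  obtain ⟨i, rfl⟩ := h₁
  obtain ⟨j, rfl⟩ := h₂
  exact ⟨j + i, Function.iterate_add_apply f j i u⟩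

theorem reach_iterate (f : V → V) (k : ℕ) (u : V) : Reach f u (f^[k] u) := ⟨k, rfl⟩

theorem reach_apply (f : V → V) (u : V) : Reach f u (f u) := ⟨1, rfl⟩

theorem Reach.mem_of_closed {f : V → V} {K : Set V} (hK : ∀ v ∈ K, f v ∈ K) {u v : V}
    (h : Reach f u v) (hu : u ∈ K) : v ∈ K := by
  obtain ⟨k, rfl⟩ := h
  induction k with
  | zero => exact hu
  | succ k ih => rw [Function.iterate_succ_apply']; exact hK _ ih

variable [Fintype V]

theorem mem_cycleVertices {f : V → V} {v : V} : v ∈ cycleVertices f ↔ Reach f (f v) v := by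
  rw [cycleVertices, Set.Finite.mem_toFinset]
  constructor
  · rintro ⟨n, hn, h⟩
    obtain ⟨k, rfl⟩ : ∃ k, n = k + 1 := ⟨n - 1, by omega⟩
    exact ⟨k, h⟩
  · rintro ⟨k, h⟩
    exact ⟨k + 1, k.succ_pos, h⟩

theorem apply_mem_cycleVertices {f : V → V} {v : V} (h : v ∈ cycleVertices f) :
    f v ∈ cycleVertices f := by
  rw [mem_cycleVertices] at *
  obtain ⟨k, hk⟩ := h
  refine ⟨k, ?_⟩
  rw [← Function.iterate_succ_apply, Function.iterate_succ_apply', hk]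

theorem not_mem_cycleVertices_of_apply {f : V → V} {u : V} (h : f u ∉ cycleVertices f) :
    u ∉ cycleVertices f := fun hu => h (apply_mem_cycleVertices hu)

theorem Reach.mem_cycleVertices {f : V → V} {u v : V} (h : Reach f u v)
    (hu : u ∈ cycleVertices f) : v ∈ cycleVertices f :=
  Finset.mem_coe.1 (h.mem_of_closed (K := ↑(cycleVertices f))
    (fun _ hv => apply_mem_cycleVertices hv) hu)

theorem Reach.symm_of_mem_cycleVertices {f : V → V} {u v : V} (h : Reach f u v)
    (hu : u ∈ cycleVertices f) : Reach f v u := by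
  obtain ⟨k, rfl⟩ := h
  induction k with
  | zero => exact Reach.refl _ _
  | succ k ih =>
    have h1 := (reach_iterate f k u).mem_cycleVertices hu
    rw [Function.iterate_succ_apply']
    exact (LineBundle.mem_cycleVertices.1 h1).trans ih

theorem iterate_mem_cycleVertices {f : V → V} {v : V} {i j : ℕ} (hij : i < j)
    (h : f^[i] v = f^[j] v) : f^[i] v ∈ cycleVertices f := by
  rw [mem_cycleVertices]
  refine ⟨j - i - 1, ?_⟩
  rw [← Function.iterate_succ_apply, ← Function.iterate_add_apply]
  rw [show (j - i - 1).succ + i = j by omega]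
  exact h.symm

theorem exists_iterate_mem_cycleVertices (f : V → V) (v : V) :
    ∃ k, 1 ≤ k ∧ f^[k] v ∈ cycleVertices f := by
  obtain ⟨i, j, hij, h⟩ := Finite.exists_ne_map_eq_of_infinite (fun k => f^[k + 1] v)
  rcases lt_or_gt_of_ne hij with h' | h'
  · exact ⟨i + 1, by omega, iterate_mem_cycleVertices (by omega) h⟩
  · exact ⟨j + 1, by omega, iterate_mem_cycleVertices (Nat.succ_lt_succ h') h.symm⟩

variable [LinearOrder V]

open Classical in
/-- The smallest vertex whose forward orbit contains `v`. -/
noncomputable def minSource (f : V → V) (v : V) : V :=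
  (Finset.univ.filter (fun u => Reach f u v)).min' ⟨v, by simp [Reach.refl]⟩

theorem reach_minSource (f : V → V) (v : V) : Reach f (minSource f v) v := by
  classical
  have := Finset.min'_mem (Finset.univ.filter (fun u => Reach f u v)) ⟨v, by simp [Reach.refl]⟩
  exact (Finset.mem_filter.1 this).2

theorem minSource_le {f : V → V} {u v : V} (h : Reach f u v) : minSource f v ≤ u :=
  Finset.min'_le _ _ (by simpa using h)

theorem minSource_anti {f : V → V} {u v : V} (h : Reach f u v) :
    minSource f v ≤ minSource f u :=
  minSource_le ((reach_minSource f u).trans h)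

theorem minSource_minSource (f : V → V) (v : V) :
    minSource f (minSource f v) = minSource f v :=
  le_antisymm (minSource_le (Reach.refl _ _)) (minSource_anti (reach_minSource f v))

theorem minSource_congr {f g : V → V} (h : ∀ u v, Reach f u v ↔ Reach g u v) (v : V) :
    minSource f v = minSource g v :=
  le_antisymm (minSource_le ((h _ _).2 (reach_minSource g v)))
    (minSource_le ((h _ _).1 (reach_minSource f v)))

/-- The vertices outside `W` whose minimal source is `r`. For `W` closed under `f`, these are the
vertices which the orbit of `r` visits first when the forward orbits of the vertices are explored
in increasing order of their starting points, starting from the explored set `W`. -/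
noncomputable def block (f : V → V) (W : Finset V) (r : V) : Finset V :=
  Finset.univ.filter (fun v => v ∉ W ∧ minSource f v = r)

theorem mem_block {f : V → V} {W : Finset V} {r v : V} :
    v ∈ block f W r ↔ v ∉ W ∧ minSource f v = r := by simp [block]

/-- All the blocks outside `W` have an even number of vertices. -/
def EvenBlocks (f : V → V) (W : Finset V) : Prop := ∀ r, Even (block f W r).card

/-! ### The partial reverse algorithm in terms of blocks -/

/-- The configurations met by the partial reverse algorithm: they contain the cycles and, of the
branches, an initial segment for the order given by the minimal source. -/
def IsStage (f : V → V) (S : Finset V) : Prop :=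
  cycleVertices f ⊆ S ∧ ∀ u v, u ∉ cycleVertices f → v ∉ cycleVertices f → u ∈ S → v ∉ S →
    minSource f u < minSource f v

theorem isStage_univ (f : V → V) : IsStage f Finset.univ :=
  ⟨Finset.subset_univ _, fun _ v _ _ _ hv => (hv (Finset.mem_univ v)).elim⟩

theorem mem_leaves {f : V → V} {S : Finset V} {v : V} :
    v ∈ leaves f S ↔ v ∈ S ∧ ∀ u ∈ S, f u ≠ v := by
  simp [leaves, incoming, Finset.filter_eq_empty_iff]

/-- A vertex which is not its own minimal source has a predecessor with the same
minimal source. -/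
theorem exists_pred_minSource {f : V → V} {v : V} (hm : minSource f v ≠ v) :
    ∃ u, f u = v ∧ minSource f u = minSource f v := by
  obtain ⟨k, hk⟩ := reach_minSource f v
  cases k with
  | zero => exact (hm hk).elim
  | succ k =>
    rw [Function.iterate_succ_apply'] at hk
    refine ⟨f^[k] (minSource f v), hk, le_antisymm (minSource_le (reach_iterate _ _ _)) ?_⟩
    conv_lhs => rw [← hk]
    exact minSource_anti (reach_apply _ _)

theorem IsStage.leaf {f : V → V} {S : Finset V} (hS : IsStage f S) {l : V}
    (hl : l ∈ leaves f S) : l ∉ cycleVertices f ∧ minSource f l = l := by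
  rw [mem_leaves] at hl
  have h1 : l ∉ cycleVertices f := by
    intro h
    obtain ⟨k, hk⟩ := mem_cycleVertices.1 h
    rw [← Function.iterate_succ_apply, Function.iterate_succ_apply'] at hk
    exact hl.2 _ (hS.1 ((reach_iterate f k l).mem_cycleVertices h)) hk
  refine ⟨h1, ?_⟩
  by_contra hm
  obtain ⟨u, hu, hmu⟩ := exists_pred_minSource hm
  have hu1 : u ∉ cycleVertices f := not_mem_cycleVertices_of_apply (hu ▸ h1)
  refine hl.2 u ?_ hu
  by_contra huS
  exact (hS.2 l u h1 hu1 hl.1 huS).ne hmu.symm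

theorem IsStage.exists_leaf {f : V → V} {S : Finset V} (hS : IsStage f S) {v : V}
    (hv : v ∈ S) (hvc : v ∉ cycleVertices f) : ∃ l ∈ leaves f S, minSource f v ≤ l := by
  obtain ⟨u, hu, hmax⟩ := (S \ cycleVertices f).exists_max_image (minSource f)
    ⟨v, by simp [hv, hvc]⟩
  rw [Finset.mem_sdiff] at hu
  have hr : minSource f u ∉ cycleVertices f := fun h =>
    hu.2 ((reach_minSource f u).mem_cycleVertices h)
  refine ⟨minSource f u, mem_leaves.2 ⟨?_, ?_⟩, hmax v (by simp [hv, hvc])⟩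
  · by_contra h
    exact (hS.2 _ _ hu.2 hr hu.1 h).ne (minSource_minSource f u).symm
  · intro w hw hwu
    have hwc : w ∉ cycleVertices f := not_mem_cycleVertices_of_apply (hwu ▸ hr)
    have h1 : minSource f w ≤ minSource f u := hmax w (by simp [hw, hwc])
    have h2 : minSource f u ≤ minSource f w := by
      have := minSource_anti (reach_apply f w)
      rwa [hwu, minSource_minSource] at this
    have h3 := reach_minSource f w
    rw [le_antisymm h1 h2, ← hwu] at h3
    exact hwc (mem_cycleVertices.2 h3)

/-- The path removed by one step of the algorithm is the block of the largest leaf. -/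
theorem IsStage.path {f : V → V} {S : Finset V} (hS : IsStage f S)
    (h : (leaves f S).Nonempty) :
    pathSources f S ((leaves f S).max' h) = block f (cycleVertices f) ((leaves f S).max' h) ∧
    pathLength f S ((leaves f S).max' h)
      = (block f (cycleVertices f) ((leaves f S).max' h)).card := by
  set l := (leaves f S).max' h with hl
  have hlS : l ∈ leaves f S := Finset.max'_mem _ _
  obtain ⟨hlc, hml⟩ := hS.leaf hlS
  have hmax : ∀ u ∈ S, u ∉ cycleVertices f → minSource f u ≤ l := by
    intro u hu huc
    obtain ⟨l', hl', hle⟩ := hS.exists_leaf hu huc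
    exact hle.trans (Finset.le_max' _ _ hl')
  have hmem : ∀ u, u ∉ cycleVertices f → minSource f u ≤ l → u ∈ S := by
    intro u huc hu
    by_contra huS
    have := hS.2 l u hlc huc (mem_leaves.1 hlS).1 huS
    rw [hml] at this
    exact absurd hu this.not_ge
  set B := block f (cycleVertices f) l with hB
  -- while the path stays in the block it does not stop
  have hcont : ∀ k, f^[k] l ∈ B → ¬ IsStop f S l (f^[k] l) := by
    intro k hk hst
    rw [hB, mem_block] at hk
    rcases hst with hst | hst | hst
    · exact hk.1 hst
    · obtain ⟨u, hu, u', hu', hne⟩ := Finset.one_lt_card.1 hst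
      have key : ∀ u ∈ incoming f S (f^[k] l), ∃ i, u = f^[i] l ∧ i + 1 = k := by
        intro u hu
        rw [incoming, Finset.mem_filter] at hu
        have huc : u ∉ cycleVertices f := not_mem_cycleVertices_of_apply (hu.2 ▸ hk.1)
        have hmu : minSource f u = l := by
          refine le_antisymm (hmax u hu.1 huc) ?_
          rw [← hk.2, ← hu.2]
          exact minSource_anti (reach_apply _ _)
        obtain ⟨i, hi⟩ := reach_minSource f u
        rw [hmu] at hi
        refine ⟨i, hi.symm, ?_⟩
        have h1 : f^[i + 1] l = f^[k] l := by rw [Function.iterate_succ_apply', hi, hu.2]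
        rcases lt_trichotomy (i + 1) k with h2 | h2 | h2
        · exact (hk.1 (h1 ▸ iterate_mem_cycleVertices h2 h1)).elim
        · exact h2
        · exact (hk.1 (iterate_mem_cycleVertices h2 h1.symm)).elim
      obtain ⟨i, rfl, hi⟩ := key u hu
      obtain ⟨i', rfl, hi'⟩ := key u' hu'
      exact hne (by rw [show i = i' by omega])
    · have := minSource_le (Reach.refl f (f^[k] l))
      rw [hk.2] at this
      exact absurd hst this.not_gt
  -- on leaving the block the path stops
  have hleave : ∀ k, f^[k] l ∈ B → f^[k + 1] l ∉ B → IsStop f S l (f^[k + 1] l) := by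
    intro k hk hk1
    rw [hB, mem_block] at hk hk1
    by_cases hc : f^[k + 1] l ∈ cycleVertices f
    · exact Or.inl hc
    right
    have hle : minSource f (f^[k + 1] l) ≤ l := minSource_le (reach_iterate _ _ _)
    have hlt : minSource f (f^[k + 1] l) < l := lt_of_le_of_ne hle fun h => hk1 ⟨hc, h⟩
    by_cases hm : minSource f (f^[k + 1] l) = f^[k + 1] l
    · right; rwa [hm] at hlt
    left
    obtain ⟨u, hu, hmu⟩ := exists_pred_minSource hm
    have huc : u ∉ cycleVertices f := not_mem_cycleVertices_of_apply (hu ▸ hc)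
    refine Finset.one_lt_card.2 ⟨f^[k] l, ?_, u, ?_, ?_⟩
    · rw [incoming, Finset.mem_filter]
      exact ⟨hmem _ hk.1 hk.2.le, (Function.iterate_succ_apply' f k l).symm⟩
    · rw [incoming, Finset.mem_filter]
      exact ⟨hmem _ huc (hmu ▸ hle), hu⟩
    · rintro rfl
      rw [hk.2] at hmu
      exact hlt.ne hmu.symm
  have hdown : ∀ k, f^[k + 1] l ∈ B → f^[k] l ∈ B := by
    intro k hk
    rw [hB, mem_block, Function.iterate_succ_apply'] at hk
    rw [hB, mem_block]
    refine ⟨not_mem_cycleVertices_of_apply hk.1,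
      le_antisymm (minSource_le (reach_iterate _ _ _)) ?_⟩
    exact hk.2.ge.trans (minSource_anti (reach_apply _ _))
  have hdown' : ∀ k j, f^[k + j] l ∈ B → f^[k] l ∈ B := by
    intro k j
    induction j with
    | zero => exact id
    | succ j ih => exact fun h => ih (hdown _ h)
  have hlB : l ∈ B := mem_block.2 ⟨hlc, hml⟩
  have hne : {k : ℕ | 1 ≤ k ∧ IsStop f S l (f^[k] l)}.Nonempty := by
    obtain ⟨k, hk, hk'⟩ := exists_iterate_mem_cycleVertices f l
    exact ⟨k, hk, Or.inl hk'⟩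
  have ht := Nat.sInf_mem hne
  set t := pathLength f S l with ht_def
  change 1 ≤ t ∧ IsStop f S l (f^[t] l) at ht
  have hmin : ∀ k < t, 1 ≤ k → ¬ IsStop f S l (f^[k] l) := fun k hk hk1 hst =>
    Nat.notMem_of_lt_sInf hk ⟨hk1, hst⟩
  have hin : ∀ k < t, f^[k] l ∈ B := by
    intro k
    induction k with
    | zero => exact fun _ => hlB
    | succ k ih =>
      intro hk
      by_contra hkB
      exact hmin _ hk (by omega) (hleave k (ih (by omega)) hkB)
  have hout : f^[t] l ∉ B := fun htB => hcont t htB ht.2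
  have hsrc : pathSources f S l = B := by
    ext v
    rw [pathSources, Finset.mem_image]
    constructor
    · rintro ⟨k, hk, rfl⟩
      exact hin k (Finset.mem_range.1 hk)
    · intro hv
      obtain ⟨k, hk⟩ := reach_minSource f v
      rw [(mem_block.1 hv).2] at hk
      refine ⟨k, Finset.mem_range.2 ?_, hk⟩
      by_contra hkt
      refine hout (hdown' t (k - t) ?_)
      rwa [show t + (k - t) = k by omega, hk]
  refine ⟨hsrc, ?_⟩
  rw [← hsrc, pathSources, Finset.card_image_of_injOn, Finset.card_range]
  intro i hi j hj hij
  have hi' := (mem_block.1 (hin i (by simpa using hi))).1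
  have hj' := (mem_block.1 (hin j (by simpa using hj))).1
  rcases lt_trichotomy i j with h2 | h2 | h2
  · exact (hi' (iterate_mem_cycleVertices h2 hij)).elim
  · exact h2
  · exact (hj' (iterate_mem_cycleVertices h2 hij.symm)).elim

theorem IsStage.step {f : V → V} {S : Finset V} (hS : IsStage f S) : IsStage f (step f S) := by
  rw [LineBundle.step]
  split_ifs with h
  · rw [(hS.path h).1]
    set l := (leaves f S).max' h with hl
    refine ⟨fun v hv => Finset.mem_sdiff.2 ⟨hS.1 hv, fun hv' => (mem_block.1 hv').1 hv⟩, ?_⟩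
    intro u v huc hvc hu hv
    rw [Finset.mem_sdiff] at hu hv
    by_cases hvS : v ∈ S
    · have hvB : v ∈ block f (cycleVertices f) l := by
        by_contra h'
        exact hv ⟨hvS, h'⟩
      obtain ⟨l', hl', hle⟩ := hS.exists_leaf hu.1 huc
      have hul : minSource f u ≤ l := hle.trans (Finset.le_max' _ _ hl')
      rw [(mem_block.1 hvB).2]
      exact lt_of_le_of_ne hul fun h' => hu.2 (mem_block.2 ⟨huc, h'⟩)
    · exact hS.2 u v huc hvc hu.1 hvS
  · exact hS

theorem isStage_iterate (f : V → V) (i : ℕ) : IsStage f ((step f)^[i] Finset.univ) := by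
  induction i with
  | zero => exact isStage_univ f
  | succ i ih => rw [Function.iterate_succ_apply']; exact ih.step

/-- Every block of the branches is removed at some stage of the algorithm. -/
theorem IsStage.even_block {f : V → V} {S : Finset V} (hS : IsStage f S)
    (hC : ∀ (i : ℕ) (h : (leaves f ((LineBundle.step f)^[i] S)).Nonempty),
      Even (pathLength f ((LineBundle.step f)^[i] S)
        ((leaves f ((LineBundle.step f)^[i] S)).max' h)))
    {v : V} (hv : v ∈ S) (hvc : v ∉ cycleVertices f) :
    Even (block f (cycleVertices f) (minSource f v)).card := by
  induction hn : S.card using Nat.strong_induction_on generalizing S with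
  | _ n ih =>
    obtain ⟨l', hl', -⟩ := hS.exists_leaf hv hvc
    have hne : (leaves f S).Nonempty := ⟨l', hl'⟩
    have h0 := hC 0 hne
    change Even (pathLength f S ((leaves f S).max' hne)) at h0
    rw [(hS.path hne).2] at h0
    by_cases hvl : minSource f v = (leaves f S).max' hne
    · rwa [hvl]
    have hstep : LineBundle.step f S
        = S \ block f (cycleVertices f) ((leaves f S).max' hne) := by
      rw [LineBundle.step, dif_pos hne, (hS.path hne).1]
    have hlS : (leaves f S).max' hne ∈ leaves f S := Finset.max'_mem _ _
    refine ih _ ?_ hS.step (fun i => ?_) ?_ rfl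
    · rw [hstep, ← hn]
      refine Finset.card_lt_card ⟨Finset.sdiff_subset, fun hsub => ?_⟩
      exact (Finset.mem_sdiff.1 (hsub (mem_leaves.1 hlS).1)).2 (mem_block.2 (hS.leaf hlS))
    · have := hC (i + 1)
      rwa [Function.iterate_succ_apply] at this
    · rw [hstep, Finset.mem_sdiff]
      exact ⟨hv, fun h => hvl (mem_block.1 h).2⟩

theorem conditionC_iff_evenBlocks (f : V → V) :
    ConditionC f ↔ EvenBlocks f (cycleVertices f) := by
  constructor
  · intro hC r
    rcases (block f (cycleVertices f) r).eq_empty_or_nonempty with h | ⟨v, hv⟩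
    · simp [h]
    · obtain ⟨hvc, rfl⟩ := mem_block.1 hv
      exact (isStage_univ f).even_block hC (Finset.mem_univ v) hvc
  · intro hE i h
    rw [((isStage_iterate f i).path h).2]
    exact hE _

end

/-! ### Sums over matchings -/

section

variable {V : Type*} [Fintype V] [LinearOrder V]

theorem prod_compl_eq_mul_prod_compl_insert {K : Finset V} {x : V} (hx : x ∉ K) (g : V → ℂ) :
    ∏ v ∈ Kᶜ, g v = g x * ∏ v ∈ (insert x K)ᶜ, g v := by
  rw [Finset.compl_insert, Finset.mul_prod_erase _ _ (Finset.mem_compl.2 hx)]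

/-- The involutions of `V` whose fixed points are exactly the elements of `K`, that is, the
perfect matchings of the complement of `K`. -/
def matchings (K : Finset V) : Finset (Equiv.Perm V) :=
  Finset.univ.filter fun ρ => (∀ v, ρ (ρ v) = v) ∧ ∀ v, ρ v = v ↔ v ∈ K

theorem mem_matchings {K : Finset V} {ρ : Equiv.Perm V} :
    ρ ∈ matchings K ↔ (∀ v, ρ (ρ v) = v) ∧ ∀ v, ρ v = v ↔ v ∈ K := by
  simp [matchings]

/-- The part of the determinant of `a`, restricted to the complement of `K`, which comes from the
perfect matchings. -/
def matchingSum (a : V → V → ℂ) (K : Finset V) : ℂ :=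
  ∑ ρ ∈ matchings K, ((Equiv.Perm.sign ρ : ℤ) : ℂ) * ∏ v ∈ Kᶜ, a v (ρ v)

theorem matchingSum_univ (a : V → V → ℂ) : matchingSum a Finset.univ = 1 := by
  have : matchings (Finset.univ : Finset V) = {1} := by
    ext ρ
    rw [mem_matchings, Finset.mem_singleton]
    constructor
    · exact fun h => Equiv.ext fun v => (h.2 v).2 (Finset.mem_univ v)
    · rintro rfl
      simp
  simp [matchingSum, this]

theorem mul_swap_mem_matchings {K : Finset V} {x u : V} (hu : u ∉ insert x K)
    {ρ : Equiv.Perm V} (hρ : ρ ∈ matchings K) (hρx : ρ x = u) :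
    ρ * Equiv.swap x u ∈ matchings (insert u (insert x K)) := by
  rw [mem_matchings] at hρ ⊢
  have hux : u ≠ x := fun h => hu (h ▸ Finset.mem_insert_self _ _)
  have hρu : ρ u = x := by rw [← hρx, hρ.1]
  have key : ∀ v, v ≠ x → v ≠ u → (ρ * Equiv.swap x u) v = ρ v := fun v h1 h2 => by
    rw [Equiv.Perm.mul_apply, Equiv.swap_apply_of_ne_of_ne h1 h2]
  have kx : (ρ * Equiv.swap x u) x = x := by simp [hρu]
  have ku : (ρ * Equiv.swap x u) u = u := by simp [hρx]
  constructor
  · intro v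
    by_cases h1 : v = x
    · rw [h1, kx, kx]
    by_cases h2 : v = u
    · rw [h2, ku, ku]
    rw [key v h1 h2, key, hρ.1]
    · exact fun h => h2 (ρ.injective (h.trans hρu.symm))
    · exact fun h => h1 (ρ.injective (h.trans hρx.symm))
  · intro v
    by_cases h1 : v = x
    · rw [h1, kx]; simp
    by_cases h2 : v = u
    · rw [h2, ku]; simp
    rw [key v h1 h2, hρ.2]; simp [h1, h2]

theorem mul_swap_mem_matchings' {K : Finset V} {x u : V} (hx : x ∉ K) (hu : u ∉ insert x K)
    {ρ : Equiv.Perm V} (hρ : ρ ∈ matchings (insert u (insert x K))) :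
    ρ * Equiv.swap x u ∈ matchings K ∧ (ρ * Equiv.swap x u) x = u := by
  rw [mem_matchings] at hρ ⊢
  have hux : u ≠ x := fun h => hu (h ▸ Finset.mem_insert_self _ _)
  have hρu : ρ u = u := (hρ.2 u).2 (by simp)
  have hρx : ρ x = x := (hρ.2 x).2 (by simp)
  have key : ∀ v, v ≠ x → v ≠ u → (ρ * Equiv.swap x u) v = ρ v := fun v h1 h2 => by
    rw [Equiv.Perm.mul_apply, Equiv.swap_apply_of_ne_of_ne h1 h2]
  have kx : (ρ * Equiv.swap x u) x = u := by simp [hρu]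
  have ku : (ρ * Equiv.swap x u) u = x := by simp [hρx]
  refine ⟨⟨?_, ?_⟩, kx⟩
  · intro v
    by_cases h1 : v = x
    · rw [h1, kx, ku]
    by_cases h2 : v = u
    · rw [h2, ku, kx]
    rw [key v h1 h2, key, hρ.1]
    · exact fun h => h1 (ρ.injective (h.trans hρx.symm))
    · exact fun h => h2 (ρ.injective (h.trans hρu.symm))
  · intro v
    by_cases h1 : v = x
    · rw [h1, kx]; simp [hux, hx]
    by_cases h2 : v = u
    · rw [h2, ku]
      exact ⟨fun h => (hux h.symm).elim, fun h => (hu (Finset.mem_insert_of_mem h)).elim⟩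
    rw [key v h1 h2, hρ.2]; simp [h1, h2]

/-- Expansion of the sum over matchings along the partner `u` of a given vertex `x`. -/
theorem matchingSum_eq_sum (a : V → V → ℂ) (ha : ∀ i j, a j i = -a i j) {K : Finset V} {x : V}
    (hx : x ∉ K) :
    matchingSum a K =
      ∑ u ∈ (insert x K)ᶜ, a x u * (a x u * matchingSum a (insert u (insert x K))) := by
  have hmaps : ∀ ρ ∈ matchings K, ρ x ∈ (insert x K)ᶜ := by
    intro ρ hρ
    rw [mem_matchings] at hρ
    have h1 : ρ x ≠ x := fun h => hx ((hρ.2 x).1 h)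
    have h2 : ρ x ∉ K := fun h => h1 (by rw [← (hρ.2 _).2 h, hρ.1])
    simp [h1, h2]
  rw [matchingSum, ← Finset.sum_fiberwise_of_maps_to hmaps]
  refine Finset.sum_congr rfl fun u hu => ?_
  rw [Finset.mem_compl] at hu
  have hux : u ≠ x := fun h => hu (h ▸ Finset.mem_insert_self _ _)
  rw [matchingSum, Finset.mul_sum, Finset.mul_sum]
  refine Finset.sum_nbij' (fun ρ => ρ * Equiv.swap x u) (fun ρ => ρ * Equiv.swap x u)
    ?_ ?_ ?_ ?_ ?_
  · intro ρ hρ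
    rw [Finset.mem_filter] at hρ
    exact mul_swap_mem_matchings hu hρ.1 hρ.2
  · intro ρ hρ
    rw [Finset.mem_filter]
    exact mul_swap_mem_matchings' hx hu hρ
  · intro ρ _; simp [mul_assoc]
  · intro ρ _; simp [mul_assoc]
  · intro ρ hρ
    rw [Finset.mem_filter] at hρ
    have hρu : ρ u = x := by rw [← hρ.2, (mem_matchings.1 hρ.1).1]
    have hprod : ∏ v ∈ (insert u (insert x K))ᶜ, a v ((ρ * Equiv.swap x u) v)
        = ∏ v ∈ (insert u (insert x K))ᶜ, a v (ρ v) := by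
      refine Finset.prod_congr rfl fun v hv => ?_
      simp only [Finset.mem_compl, Finset.mem_insert, not_or] at hv
      rw [Equiv.Perm.mul_apply, Equiv.swap_apply_of_ne_of_ne hv.2.1 hv.1]
    rw [hprod, prod_compl_eq_mul_prod_compl_insert hx, prod_compl_eq_mul_prod_compl_insert hu,
      hρ.2, hρu, ha x u, Equiv.Perm.sign_mul, Equiv.Perm.sign_swap hux.symm]
    push_cast
    ring

/-! ### Exploration of a configuration -/

theorem card_compl_insert_lt {K : Finset V} {x : V} (hx : x ∉ K) :
    (insert x K)ᶜ.card < Kᶜ.card :=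
  Finset.card_lt_card (Finset.compl_ssubset_compl.2 (Finset.ssubset_insert hx))

open Classical in
/-- The maps `V → V` which agree with `p` on `K`. -/
noncomputable def extensions (p : V → V) (K : Finset V) : Finset (V → V) :=
  Finset.univ.filter fun f => ∀ v ∈ K, f v = p v

theorem mem_extensions {p f : V → V} {K : Finset V} :
    f ∈ extensions p K ↔ ∀ v ∈ K, f v = p v := by
  simp [extensions]

/-- Summation over the value at a further vertex `x`. -/
theorem sum_extensions (p : V → V) {K : Finset V} {x : V} (hx : x ∉ K) (F : (V → V) → ℂ) :
    ∑ f ∈ extensions p K, F f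
      = ∑ w, ∑ f ∈ extensions (Function.update p x w) (insert x K), F f := by
  classical
  rw [← Finset.sum_fiberwise (extensions p K) (fun f => f x)]
  refine Finset.sum_congr rfl fun w _ => Finset.sum_congr ?_ fun _ _ => rfl
  ext f
  rw [Finset.mem_filter, mem_extensions, mem_extensions]
  constructor
  · rintro ⟨h1, h2⟩ v hv
    rcases Finset.mem_insert.1 hv with rfl | hv
    · simp [h2]
    · rw [Function.update_of_ne (ne_of_mem_of_not_mem hv hx), h1 v hv]
  · intro h
    refine ⟨fun v hv => ?_, by simpa using h x (Finset.mem_insert_self _ _)⟩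
    rw [h v (Finset.mem_insert_of_mem hv), Function.update_of_ne (ne_of_mem_of_not_mem hv hx)]

/-- The configuration has no cycle of length at most `2` outside `K`, and its blocks outside `K`
are even. -/
def IsEvenOutside (f : V → V) (K : Finset V) : Prop :=
  (∀ v ∉ K, f (f v) ≠ v) ∧ EvenBlocks f K

/-- Explore the forward orbit of the smallest vertex `r` outside a closed set `K`, up to the
enlarged closed set `K'`: the newly visited vertices form a block, and the other blocks do not
change. -/
theorem evenBlocks_iff_of_closed {f : V → V} {K K' : Finset V} {r : V}
    (hK : ∀ v ∈ K, f v ∈ K) (hKK' : K ⊆ K') (hK' : ∀ v ∈ K', f v ∈ K') (hrK' : r ∈ K')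
    (hmin : ∀ v ∉ K, r ≤ v) (hreach : ∀ v ∈ K', v ∉ K → Reach f r v) :
    EvenBlocks f K ↔ Even (K' \ K).card ∧ EvenBlocks f K' := by
  have hsrc : ∀ v ∉ K, minSource f v ∉ K := fun v hv h =>
    hv (Finset.mem_coe.1 ((reach_minSource f v).mem_of_closed (K := (K : Set V))
      (by simpa using hK) (by simpa using h)))
  have hreach' : ∀ v, Reach f r v → v ∈ K' := fun v h =>
    Finset.mem_coe.1 (h.mem_of_closed (K := (K' : Set V)) (by simpa using hK')
      (by simpa using hrK'))
  have hiff : ∀ v ∉ K, (minSource f v = r ↔ v ∈ K') := by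
    intro v hv
    constructor
    · intro h
      exact hreach' v (h ▸ reach_minSource f v)
    · intro h
      exact le_antisymm (minSource_le (hreach v h hv)) (hmin _ (hsrc v hv))
  have h1 : block f K r = K' \ K := by
    ext v
    rw [mem_block, Finset.mem_sdiff]
    constructor
    · rintro ⟨h, h'⟩; exact ⟨(hiff v h).1 h', h⟩
    · rintro ⟨h, h'⟩; exact ⟨h', (hiff v h').2 h⟩
  have h2 : block f K' r = ∅ := by
    ext v
    rw [mem_block]
    simp only [Finset.notMem_empty, iff_false]
    rintro ⟨h, h'⟩
    exact h ((hiff v fun hv => h (hKK' hv)).1 h')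
  have h3 : ∀ s, s ≠ r → block f K s = block f K' s := by
    intro s hs
    ext v
    rw [mem_block, mem_block]
    constructor
    · rintro ⟨h, h'⟩
      exact ⟨fun hv => hs (h' ▸ (hiff v h).2 hv), h'⟩
    · rintro ⟨h, h'⟩
      exact ⟨fun hv => h (hKK' hv), h'⟩
  constructor
  · intro h
    refine ⟨h1 ▸ h r, fun s => ?_⟩
    by_cases hs : s = r
    · rw [hs, h2]; simp
    · rw [← h3 s hs]; exact h s
  · rintro ⟨h, h'⟩ s
    by_cases hs : s = r
    · rw [hs, h1]; exact h
    · rw [h3 s hs]; exact h' s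

open Classical in
/-- The weighted sum over the configurations which agree with `p` on `L`, have even blocks outside
`K` and no short cycles outside `K`. The weight is the product of the entries of `a` over the edges
starting outside `L`. -/
noncomputable def explorationSum (a : V → V → ℂ) (K L : Finset V) (p : V → V) : ℂ :=
  ∑ f ∈ extensions p L, if IsEvenOutside f K then ∏ v ∈ Lᶜ, a v (f v) else 0

theorem explorationSum_eq_sum (a : V → V → ℂ) (K : Finset V) {L : Finset V} (p : V → V) {x : V}
    (hx : x ∉ L) :
    explorationSum a K L p
      = ∑ w, a x w * explorationSum a K (insert x L) (Function.update p x w) := by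
  rw [explorationSum, sum_extensions p hx]
  refine Finset.sum_congr rfl fun w _ => ?_
  rw [explorationSum, Finset.mul_sum]
  refine Finset.sum_congr rfl fun f hf => ?_
  split_ifs with h
  · rw [prod_compl_eq_mul_prod_compl_insert hx,
      show f x = w by simpa using mem_extensions.1 hf x (Finset.mem_insert_self _ _)]
  · simp

theorem explorationSum_eq_zero (a : V → V → ℂ) {K L : Finset V} {p : V → V}
    (h : ∀ f ∈ extensions p L, ¬ IsEvenOutside f K) : explorationSum a K L p = 0 :=
  Finset.sum_eq_zero fun f hf => if_neg (h f hf)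

theorem explorationSum_congr (a : V → V → ℂ) {K K' L : Finset V} {p : V → V}
    (h : ∀ f ∈ extensions p L, IsEvenOutside f K ↔ IsEvenOutside f K') :
    explorationSum a K L p = explorationSum a K' L p :=
  Finset.sum_congr rfl fun f hf => by classical exact if_congr (h f hf) rfl rfl

/-- Data of a partial exploration: the forward orbit of the smallest vertex `r` outside the closed
set `K` has been followed up to the vertex `x`, and `L` consists of `K` and of the vertices of the
orbit before `x`. -/
structure IsExploration (K : Finset V) (r : V) (L : Finset V) (x : V) (p : V → V) : Prop where
  closed : ∀ v ∈ K, p v ∈ K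
  root_notMem : r ∉ K
  root_le : ∀ v ∉ K, r ≤ v
  subset : K ⊆ L
  notMem : x ∉ L
  root_mem : r ∈ insert x L
  apply_mem : ∀ v ∈ L, p v ∈ insert x L
  reach : ∀ f ∈ extensions p L, ∀ v ∈ insert x L, v ∉ K → Reach f r v
  no_two : ∀ v ∈ L, v ∉ K → p v ∈ L → p (p v) ≠ v

theorem extensions_update_subset {p : V → V} {L : Finset V} {x w : V} (hx : x ∉ L) :
    extensions (Function.update p x w) (insert x L) ⊆ extensions p L := by
  intro f hf
  rw [mem_extensions] at hf ⊢
  intro v hv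
  rw [hf v (Finset.mem_insert_of_mem hv), Function.update_of_ne (ne_of_mem_of_not_mem hv hx)]

namespace IsExploration

variable {K : Finset V} {r : V} {L : Finset V} {x : V} {p : V → V}

/-- The orbit goes on to an unvisited vertex. -/
theorem update_of_notMem (h : IsExploration K r L x p) {u : V} (hu : u ∉ insert x L) :
    IsExploration K r (insert x L) u (Function.update p x u) where
  closed v hv := by
    rw [Function.update_of_ne (ne_of_mem_of_not_mem (h.subset hv) h.notMem)]
    exact h.closed v hv
  root_notMem := h.root_notMem
  root_le := h.root_le
  subset := h.subset.trans (Finset.subset_insert _ _)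
  notMem := hu
  root_mem := Finset.mem_insert_of_mem h.root_mem
  apply_mem v hv := by
    rcases Finset.mem_insert.1 hv with rfl | hv
    · simp
    · rw [Function.update_of_ne (ne_of_mem_of_not_mem hv h.notMem)]
      exact Finset.mem_insert_of_mem (h.apply_mem v hv)
  reach f hf v hv hvK := by
    have hf' := extensions_update_subset h.notMem hf
    rcases Finset.mem_insert.1 hv with rfl | hv
    · have hx := h.reach f hf' x (Finset.mem_insert_self _ _) fun e => h.notMem (h.subset e)
      have := mem_extensions.1 hf x (Finset.mem_insert_self _ _)
      rw [Function.update_self] at this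
      exact hx.trans ⟨1, this⟩
    · exact h.reach f hf' v hv hvK
  no_two v hv hvK hpv := by
    rcases Finset.mem_insert.1 hv with rfl | hv
    · rw [Function.update_self] at hpv
      exact (hu hpv).elim
    · rw [Function.update_of_ne (ne_of_mem_of_not_mem hv h.notMem)] at hpv ⊢
      by_cases hpx : p v = x
      · rw [hpx, Function.update_self]
        exact fun e => hu (e ▸ Finset.mem_insert_of_mem hv)
      · rw [Function.update_of_ne hpx]
        exact h.no_two v hv hvK (Finset.mem_of_mem_insert_of_ne hpv hpx)

/-- The orbit comes back to a visited vertex. -/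
theorem evenBlocks_iff_of_mem (h : IsExploration K r L x p) {u : V} (hu : u ∈ insert x L)
    {f : V → V} (hf : f ∈ extensions (Function.update p x u) (insert x L)) :
    EvenBlocks f K ↔ Even (insert x L \ K).card ∧ EvenBlocks f (insert x L) := by
  have hf' := mem_extensions.1 (extensions_update_subset h.notMem hf)
  have hfx := mem_extensions.1 hf x (Finset.mem_insert_self _ _)
  rw [Function.update_self] at hfx
  refine evenBlocks_iff_of_closed (r := r) ?_ (h.subset.trans (Finset.subset_insert _ _)) ?_
    h.root_mem h.root_le (h.reach f (extensions_update_subset h.notMem hf))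
  · intro v hv
    rw [hf' v (h.subset hv)]
    exact h.closed v hv
  · intro v hv
    rcases Finset.mem_insert.1 hv with rfl | hv
    · rwa [hfx]
    · rw [hf' v hv]
      exact h.apply_mem v hv

theorem closed_of_mem (h : IsExploration K r L x p) {u : V} (hu : u ∈ insert x L) :
    ∀ v ∈ insert x L, Function.update p x u v ∈ insert x L := by
  intro v hv
  rcases Finset.mem_insert.1 hv with rfl | hv
  · simpa using hu
  · rw [Function.update_of_ne (ne_of_mem_of_not_mem hv h.notMem)]
    exact h.apply_mem v hv

end IsExploration

theorem card_insert_sdiff {X : Type*} [DecidableEq X] {K L : Finset X} {x : X} (hKL : K ⊆ L)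
    (hx : x ∉ L) :
    (insert x L \ K).card = (L \ K).card + 1 := by
  rw [Finset.insert_sdiff_of_notMem _ (fun h => hx (hKL h)), Finset.card_insert_of_notMem]
  simp [hx]

/-- One round of the exploration. The successor `u` of `x` has to be unvisited, for parity reasons;
since the rows of `a` sum to zero, summing over the successors of `u` other than `x` replaces
the weight of the next edge by `a x u`. -/
theorem IsExploration.sum_eq (a : V → V → ℂ) (ha : ∀ i j, a j i = -a i j)
    (hsum : ∀ i, ∑ j, a i j = 0) {K : Finset V} {r : V}
    (hK : ∀ L, K ⊂ L → ∀ p : V → V, (∀ v ∈ L, p v ∈ L) →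
      explorationSum a L L p = matchingSum a L)
    {L : Finset V} {x : V} {p : V → V} (h : IsExploration K r L x p)
    (heven : Even (L \ K).card) :
    explorationSum a K L p = matchingSum a L := by
  induction hn : Lᶜ.card using Nat.strong_induction_on generalizing L x p with
  | _ n ih =>
  have hdiag : ∀ i, a i i = 0 := fun i => by
    have := ha i i
    linear_combination this / 2
  have hxK : x ∉ K := fun e => h.notMem (h.subset e)
  rw [explorationSum_eq_sum a K p h.notMem, matchingSum_eq_sum a ha h.notMem]
  symm
  refine Finset.sum_subset_zero_on_sdiff (Finset.subset_univ _) ?_ ?_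
  · intro u hu
    have hu : u ∈ insert x L := by
      by_contra hu'
      exact (Finset.mem_sdiff.1 hu).2 (Finset.mem_compl.2 hu')
    rw [explorationSum_eq_zero, mul_zero]
    intro f hf hE
    have := ((h.evenBlocks_iff_of_mem hu hf).1 hE.2).1
    rw [card_insert_sdiff h.subset h.notMem] at this
    exact (Nat.not_even_iff_odd.2 heven.add_one) this
  intro u hu
  have hu : u ∉ insert x L := Finset.mem_compl.1 hu
  have h' := h.update_of_notMem hu
  have hux : u ≠ x := fun e => hu (e ▸ Finset.mem_insert_self _ _)
  have heven' : Even (insert u (insert x L) \ K).card := by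
    rw [card_insert_sdiff h'.subset hu, card_insert_sdiff h.subset h.notMem]
    obtain ⟨k, hk⟩ := heven
    exact ⟨k + 1, by omega⟩
  congr 1
  rw [explorationSum_eq_sum a K _ hu]
  have hterm : ∀ w, a u w * explorationSum a K (insert u (insert x L))
      (Function.update (Function.update p x u) u w)
      = (if w = x then 0 else a u w) * matchingSum a (insert u (insert x L)) := by
    intro w
    by_cases hwx : w = x
    · -- here `x → u → x` would be a cycle of length two
      rw [if_pos hwx, explorationSum_eq_zero, mul_zero, zero_mul]
      intro f hf hE
      have h1 := mem_extensions.1 hf u (Finset.mem_insert_self _ _)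
      have h2 := mem_extensions.1 hf x (by simp)
      rw [Function.update_self] at h1
      rw [Function.update_of_ne hux.symm, Function.update_self] at h2
      exact hE.1 x hxK (by rw [h2, h1, hwx])
    rw [if_neg hwx]
    by_cases hwu : w = u
    · rw [hwu, hdiag]; simp
    congr 1
    by_cases hw : w ∈ insert u (insert x L)
    · rw [← hK (insert u (insert x L)) ?_ _ (h'.closed_of_mem hw)]
      · refine explorationSum_congr a fun f hf => ?_
        have hE := h'.evenBlocks_iff_of_mem hw hf
        have hfu := mem_extensions.1 hf u (Finset.mem_insert_self _ _)
        rw [Function.update_self] at hfu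
        have hf1 := extensions_update_subset hu hf
        have hfx := mem_extensions.1 hf1 x (Finset.mem_insert_self _ _)
        rw [Function.update_self] at hfx
        have hf2 := mem_extensions.1 (extensions_update_subset h.notMem hf1)
        rw [IsEvenOutside, IsEvenOutside, hE]
        refine ⟨fun H => ⟨fun v hv => H.1 v fun e =>
          hv (h'.subset.trans (Finset.subset_insert _ _) e),
          H.2.2⟩, fun H => ⟨fun v hv => ?_, heven', H.2⟩⟩
        by_cases hvL : v ∈ insert u (insert x L)
        · rcases Finset.mem_insert.1 hvL with rfl | hvL
          · rw [hfu]
            intro e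
            -- the unvisited vertex has no visited predecessor but `x`
            rcases Finset.mem_insert.1 (Finset.mem_of_mem_insert_of_ne hw hwu) with e' | e'
            · exact hwx e'
            · rw [hf2 w e'] at e
              exact hu (e ▸ h.apply_mem w e')
          · rcases Finset.mem_insert.1 hvL with rfl | hvL
            · rw [hfx, hfu]; exact hwx
            · rw [hf2 v hvL]
              by_cases hpx : p v = x
              · rw [hpx, hfx]
                exact fun e => hu (e ▸ Finset.mem_insert_of_mem hvL)
              · have hpL := Finset.mem_of_mem_insert_of_ne (h.apply_mem v hvL) hpx
                rw [hf2 _ hpL]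
                exact h.no_two v hvL hv hpL
        · exact H.1 v hvL
      · exact h.subset.trans_ssubset ((Finset.ssubset_insert h.notMem).trans
          (Finset.ssubset_insert hu))
    · refine ih _ ?_ (h'.update_of_notMem hw) heven' rfl
      rw [← hn]
      exact (card_compl_insert_lt hu).trans (card_compl_insert_lt h.notMem)
  rw [Finset.sum_congr rfl fun w _ => hterm w, ← Finset.sum_mul]
  congr 1
  have h0 := hsum u
  rw [← Finset.add_sum_erase _ _ (Finset.mem_univ x)] at h0
  rw [← Finset.add_sum_erase _ _ (Finset.mem_univ x), if_pos rfl, zero_add,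
    Finset.sum_congr rfl fun w hw => if_neg (Finset.ne_of_mem_erase hw)]
  linear_combination -h0 + ha x u

/-- The sum over the configurations with even blocks outside a closed set is the sum over the
perfect matchings of the complement. -/
theorem explorationSum_eq_matchingSum (a : V → V → ℂ) (ha : ∀ i j, a j i = -a i j)
    (hsum : ∀ i, ∑ j, a i j = 0) (K : Finset V) (p : V → V) (hp : ∀ v ∈ K, p v ∈ K) :
    explorationSum a K K p = matchingSum a K := by
  induction hn : Kᶜ.card using Nat.strong_induction_on generalizing K p with
  | _ n ih =>
  rcases Kᶜ.eq_empty_or_nonempty with h | h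
  · rw [Finset.compl_eq_empty_iff] at h
    subst h
    have hext : extensions p Finset.univ = {p} := by
      ext f
      simp [mem_extensions, funext_iff]
    rw [matchingSum_univ, explorationSum, hext, Finset.sum_singleton, if_pos]
    · simp
    · refine ⟨fun v hv => (hv (Finset.mem_univ v)).elim, fun r => ?_⟩
      simp [block]
  · have hr : Kᶜ.min' h ∉ K := Finset.mem_compl.1 (Finset.min'_mem _ _)
    refine IsExploration.sum_eq a ha hsum (r := Kᶜ.min' h) (x := Kᶜ.min' h) ?_ ?_ (by simp)
    · intro L hL q hq
      exact ih _ (hn ▸ Finset.card_lt_card (Finset.compl_ssubset_compl.2 hL)) L q hq rfl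
    · exact
        { closed := hp
          root_notMem := hr
          root_le := fun v hv => Finset.min'_le _ _ (Finset.mem_compl.2 hv)
          subset := subset_rfl
          notMem := hr
          root_mem := Finset.mem_insert_self _ _
          apply_mem := fun v hv => Finset.mem_insert_of_mem (hp v hv)
          reach := fun f _ v hv hvK => by
            rcases Finset.mem_insert.1 hv with rfl | hv
            · exact Reach.refl _ _
            · exact (hvK hv).elim
          no_two := fun v hv hvK => (hvK hv).elim }

end

/-! ### The determinant as a sum over the cycles of length at least three -/

section

variable {V : Type*} [Fintype V] [LinearOrder V]

open Classical in
/-- The permutation which is given by `f` on `W` and which fixes the other elements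
(the identity if this is not a permutation). -/
noncomputable def permOn (f : V → V) (W : Finset V) : Equiv.Perm V :=
  if h : Function.Bijective (fun v => if v ∈ W then f v else v) then Equiv.ofBijective _ h else 1

theorem permOn_apply {f : V → V} {W : Finset V} (hmaps : ∀ v ∈ W, f v ∈ W)
    (hinj : Set.InjOn f W) (v : V) : permOn f W v = if v ∈ W then f v else v := by
  have h : Function.Bijective (fun v => if v ∈ W then f v else v) := by
    rw [← Finite.injective_iff_bijective]
    intro u v huv
    by_cases hu : u ∈ W <;> by_cases hv : v ∈ W <;> simp only [hu, hv, if_true, if_false] at huv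
    · exact hinj hu hv huv
    · exact (hv (huv ▸ hmaps u hu)).elim
    · exact (hu (huv ▸ hmaps v hv)).elim
    · exact huv
  rw [permOn, dif_pos h, Equiv.ofBijective_apply]

/-- All the non-trivial cycles of `τ` have length at least three. -/
def HasLongCycles (τ : Equiv.Perm V) : Prop := ∀ v, τ v ≠ v → τ (τ v) ≠ v

theorem HasLongCycles.sq_mul_iff {τ ρ : Equiv.Perm V} (hτ : HasLongCycles τ)
    (hρ : ρ ∈ matchings τ.support) (v : V) :
    (τ * ρ) ((τ * ρ) v) ≠ v ↔ v ∈ τ.support := by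
  rw [mem_matchings] at hρ
  by_cases hv : v ∈ τ.support
  · have h1 : (τ * ρ) v = τ v := by rw [Equiv.Perm.mul_apply, (hρ.2 v).2 hv]
    have h2 : (τ * ρ) (τ v) = τ (τ v) := by
      rw [Equiv.Perm.mul_apply, (hρ.2 _).2 (Equiv.Perm.apply_mem_support.2 hv)]
    rw [h1, h2]
    exact ⟨fun _ => hv, fun _ => hτ v (Equiv.Perm.mem_support.1 hv)⟩
  · have hρv : ρ v ∉ τ.support := fun h => hv (by
      have := (hρ.2 _).2 h
      rw [hρ.1] at this
      rwa [← this] at h)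
    have h1 : (τ * ρ) v = ρ v := by
      rw [Equiv.Perm.mul_apply]; exact Equiv.Perm.notMem_support.1 hρv
    have h2 : (τ * ρ) (ρ v) = v := by
      rw [Equiv.Perm.mul_apply, hρ.1]; exact Equiv.Perm.notMem_support.1 hv
    rw [h1, h2]
    simp [hv]

/-- Sums over the permutations without fixed points, organised according to the cycles of length at
least three. -/
theorem sum_perm_eq_sum_longCycles (F : Equiv.Perm V → ℂ)
    (hF : ∀ σ : Equiv.Perm V, ∀ v, σ v = v → F σ = 0) :
    ∑ σ, F σ = ∑ τ : Equiv.Perm V with ∀ v, τ v ≠ v → τ (τ v) ≠ v,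
      ∑ ρ ∈ matchings τ.support, F (τ * ρ) := by
  rw [Finset.sum_sigma']
  have h0 : ∑ σ, F σ = ∑ σ : Equiv.Perm V with ∀ v, σ v ≠ v, F σ := by
    symm
    refine Finset.sum_subset (Finset.subset_univ _) fun σ _ hσ => ?_
    simp only [Finset.mem_filter, Finset.mem_univ, true_and, not_forall, not_not] at hσ
    exact hF σ _ hσ.choose_spec
  rw [h0]
  symm
  refine Finset.sum_nbij (fun x => x.1 * x.2) ?_ ?_ ?_ fun _ _ => rfl
  · rintro ⟨τ, ρ⟩ h
    simp only [Finset.mem_sigma, Finset.mem_filter, Finset.mem_univ, true_and] at h ⊢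
    intro v hv
    have h1 := (HasLongCycles.sq_mul_iff h.1 h.2 v).not
    rw [hv, hv] at h1
    have hvs : v ∉ τ.support := h1.1 (by simp)
    have h2 := mem_matchings.1 h.2
    rw [Equiv.Perm.mul_apply] at hv
    have h3 : ρ v ∈ τ.support := by
      rw [Equiv.Perm.mem_support, hv]
      exact fun e => hvs ((h2.2 v).1 e.symm)
    have h4 := (h2.2 _).2 h3
    rw [h2.1] at h4
    exact hvs (h4 ▸ h3)
  · rintro ⟨τ, ρ⟩ h ⟨τ', ρ'⟩ h' heq
    simp only [Finset.coe_sigma, Set.mem_sigma_iff, Finset.mem_coe, Finset.mem_filter,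
      Finset.mem_univ, true_and] at h h' heq
    have hsupp : τ.support = τ'.support := by
      ext v
      rw [← HasLongCycles.sq_mul_iff h.1 h.2, ← HasLongCycles.sq_mul_iff h'.1 h'.2, heq]
    have hτ : τ = τ' := by
      ext v
      by_cases hv : v ∈ τ.support
      · have h1 := congrArg (fun σ : Equiv.Perm V => σ v) heq
        simp only [Equiv.Perm.mul_apply] at h1
        rwa [((mem_matchings.1 h.2).2 v).2 hv, ((mem_matchings.1 h'.2).2 v).2 (hsupp ▸ hv)] at h1
      · have hv' : v ∉ τ'.support := hsupp ▸ hv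
        rw [Equiv.Perm.notMem_support.1 hv, Equiv.Perm.notMem_support.1 hv']
    subst hτ
    rw [mul_left_cancel heq]
  · intro σ hσ
    simp only [Finset.coe_filter, Finset.mem_univ, true_and, Set.mem_ofPred_eq] at hσ
    set W : Finset V := Finset.univ.filter fun v => σ (σ v) ≠ v with hW
    have hmem : ∀ v, v ∈ W ↔ σ (σ v) ≠ v := by simp [hW]
    have hmem' : ∀ v, v ∈ Wᶜ ↔ σ (σ v) = v := by simp [hW]
    have hτ := permOn_apply (f := σ) (W := W)
      (fun v hv => (hmem _).2 fun e => (hmem v).1 hv (σ.injective e)) σ.injective.injOn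
    have hρ := permOn_apply (f := σ) (W := Wᶜ)
      (fun v hv => (hmem' _).2 (by rw [(hmem' v).1 hv])) σ.injective.injOn
    have hsupp : (permOn σ W).support = W := by
      ext v
      rw [Equiv.Perm.mem_support, hτ]
      by_cases hv : v ∈ W <;> simp [hv, hσ v]
    have hσW : ∀ v, σ v ∈ W ↔ v ∈ W := fun v => by
      rw [hmem, hmem, not_iff_not]
      exact ⟨fun e => σ.injective e, fun e => by rw [e]⟩
    refine ⟨⟨permOn σ W, permOn σ Wᶜ⟩, ?_, ?_⟩
    · simp only [Finset.coe_sigma, Set.mem_sigma_iff, Finset.mem_coe, Finset.mem_filter,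
        Finset.mem_univ, true_and]
      constructor
      · intro v hv
        rw [← Equiv.Perm.mem_support, hsupp] at hv
        rw [hτ v, if_pos hv, hτ, if_pos ((hσW v).2 hv)]
        exact (hmem v).1 hv
      · rw [hsupp, mem_matchings]
        refine ⟨fun v => ?_, fun v => ?_⟩
        · by_cases hv : v ∈ W
          · rw [hρ v, if_neg (by simpa using hv), hρ, if_neg (by simpa using hv)]
          · rw [hρ v, if_pos (by simpa using hv), hρ, if_pos (by simpa [hσW] using hv)]
            simpa [hmem] using hv
        · rw [hρ]
          by_cases hv : v ∈ W <;> simp [hv, hσ v]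
    · ext v
      rw [Equiv.Perm.mul_apply, hρ]
      by_cases hv : v ∈ W
      · rw [if_neg (by simpa using hv), hτ, if_pos hv]
      · rw [if_pos (by simpa using hv), hτ, if_neg (by simpa [hσW] using hv)]

theorem graphOf_adj {X : Type*} {A : Matrix X X ℂ} (hskew : ∀ i j, A j i = -A i j) {u v : X} :
    (graphOf A).Adj u v ↔ A u v ≠ 0 := by
  rw [graphOf, SimpleGraph.fromRel_adj]
  constructor
  · rintro ⟨-, h | h⟩
    · exact h
    · rw [hskew] at h; simpa using h
  · intro h
    refine ⟨?_, Or.inl h⟩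
    rintro rfl
    have := hskew u u
    exact h (by linear_combination this / 2)

/-- The connection does not contribute to the cycles of length two. -/
theorem prod_twist_matching {A : Matrix V V ℂ} (hskew : ∀ i j, A j i = -A i j)
    (ψ : Connection (graphOf A)) {K : Finset V} {ρ : Equiv.Perm V} (hρ : ρ ∈ matchings K) :
    ∏ v ∈ Kᶜ, twist A ψ v (ρ v) = ∏ v ∈ Kᶜ, A v (ρ v) := by
  rw [mem_matchings] at hρ
  simp only [twist, Matrix.of_apply]
  rw [Finset.prod_mul_distrib]
  by_cases h0 : ∃ v ∈ Kᶜ, A v (ρ v) = 0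
  · obtain ⟨v, hv, h⟩ := h0
    rw [Finset.prod_eq_zero hv h, zero_mul]
  · push Not at h0
    convert mul_one _
    refine Finset.prod_involution (fun v _ => ρ v) ?_ ?_ ?_ ?_
    · intro v hv
      rw [hρ.1, ψ.transport_symm v (ρ v) ((graphOf_adj hskew).2 (h0 v hv)), ← Units.val_mul]
      simp
    · intro v hv _ h
      exact Finset.mem_compl.1 hv ((hρ.2 v).1 h)
    · intro v hv
      rw [Finset.mem_compl] at hv ⊢
      exact fun h => hv (by
        have h1 := (hρ.2 _).2 h
        rw [hρ.1] at h1
        rwa [← h1] at h)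
    · intro v _
      exact hρ.1 v

theorem det_twist_eq_sum {A : Matrix V V ℂ} (hskew : ∀ i j, A j i = -A i j)
    (ψ : Connection (graphOf A)) :
    (twist A ψ).det = ∑ τ : Equiv.Perm V with ∀ v, τ v ≠ v → τ (τ v) ≠ v,
      ((Equiv.Perm.sign τ : ℤ) : ℂ) * (∏ v ∈ τ.support, twist A ψ v (τ v))
        * matchingSum A τ.support := by
  have hdiag : ∀ v, twist A ψ v v = 0 := fun v => by
    have := hskew v v
    have h0 : A v v = 0 := by linear_combination this / 2
    simp [twist, h0]
  rw [← Matrix.det_transpose, Matrix.det_apply']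
  simp only [Matrix.transpose_apply]
  rw [sum_perm_eq_sum_longCycles]
  · refine Finset.sum_congr rfl fun τ _ => ?_
    unfold matchingSum
    rw [Finset.mul_sum]
    refine Finset.sum_congr rfl fun ρ hρ => ?_
    have hρ' := mem_matchings.1 hρ
    have h1 : ∏ v ∈ τ.support, twist A ψ v ((τ * ρ) v)
        = ∏ v ∈ τ.support, twist A ψ v (τ v) :=
      Finset.prod_congr rfl fun v hv => by rw [Equiv.Perm.mul_apply, (hρ'.2 v).2 hv]
    have h2 : ∏ v ∈ τ.supportᶜ, twist A ψ v ((τ * ρ) v)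
        = ∏ v ∈ τ.supportᶜ, twist A ψ v (ρ v) :=
      Finset.prod_congr rfl fun v hv => by
        rw [Finset.mem_compl] at hv
        rw [Equiv.Perm.mul_apply]
        congr 1
        refine Equiv.Perm.notMem_support.1 fun h => hv ?_
        have h3 := (hρ'.2 _).2 h
        rw [hρ'.1] at h3
        rwa [← h3] at h
    rw [← Finset.prod_mul_prod_compl τ.support, h1, h2, prod_twist_matching hskew ψ hρ,
      Equiv.Perm.sign_mul]
    push_cast
    ring
  · intro σ v hv
    rw [Finset.prod_eq_zero (Finset.mem_univ v), mul_zero]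
    rw [hv, hdiag]

/-! ### Sets of cycles of a configuration and permutations -/

theorem injOn_cycleVertices {X : Type*} [Fintype X] (f : X → X) :
    Set.InjOn f (cycleVertices f) := by
  simpa [cycleVertices] using (Function.bijOn_periodicPts f).injOn

theorem mem_cycleThrough {f : V → V} {u v : V} (hv : v ∈ cycleVertices f) :
    u ∈ cycleThrough f v ↔ Reach f v u := by
  rw [cycleThrough, Finset.mem_image]
  constructor
  · rintro ⟨k, -, rfl⟩
    exact reach_iterate f k v
  · rintro ⟨k, rfl⟩
    have hv' : v ∈ Function.periodicPts f := by simpa [cycleVertices] using hv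
    exact ⟨k % Function.minimalPeriod f v,
      Finset.mem_range.2 (Nat.mod_lt _ (Function.minimalPeriod_pos_of_mem_periodicPts hv')),
      Function.iterate_mod_minimalPeriod_eq⟩

theorem subset_cycleVertices {f : V → V} {C : Finset V} (hC : C ∈ cycles f) :
    C ⊆ cycleVertices f := by
  obtain ⟨v, hv, rfl⟩ := Finset.mem_image.1 hC
  exact fun u hu => ((mem_cycleThrough hv).1 hu).mem_cycleVertices hv

theorem eq_cycleThrough {f : V → V} {C : Finset V} (hC : C ∈ cycles f) {v : V} (hv : v ∈ C) :
    C = cycleThrough f v := by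
  have hvc := subset_cycleVertices hC hv
  obtain ⟨w, hw, rfl⟩ := Finset.mem_image.1 hC
  rw [mem_cycleThrough hw] at hv
  ext u
  rw [mem_cycleThrough hw, mem_cycleThrough hvc]
  exact ⟨(hv.symm_of_mem_cycleVertices hw).trans, hv.trans⟩

theorem cycle_nonempty {f : V → V} {C : Finset V} (hC : C ∈ cycles f) : C.Nonempty := by
  obtain ⟨w, hw, rfl⟩ := Finset.mem_image.1 hC
  exact ⟨w, (mem_cycleThrough hw).2 (Reach.refl _ _)⟩

theorem eq_of_mem_cycles {f : V → V} {C C' : Finset V} (hC : C ∈ cycles f) (hC' : C' ∈ cycles f)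
    {v : V} (hv : v ∈ C) (hv' : v ∈ C') : C = C' :=
  (eq_cycleThrough hC hv).trans (eq_cycleThrough hC' hv').symm

theorem reach_of_mem_cycle {f : V → V} {C : Finset V} (hC : C ∈ cycles f) {u v : V}
    (hu : u ∈ C) (hv : v ∈ C) : Reach f u v := by
  rw [eq_cycleThrough hC hu] at hv
  exact (mem_cycleThrough (subset_cycleVertices hC hu)).1 hv

theorem mem_cycle_of_reach {f : V → V} {C : Finset V} (hC : C ∈ cycles f) {u v : V}
    (hu : u ∈ C) (h : Reach f u v) : v ∈ C := by
  rw [eq_cycleThrough hC hu]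
  exact (mem_cycleThrough (subset_cycleVertices hC hu)).2 h

theorem pairwiseDisjoint_cycles (f : V → V) :
    Set.PairwiseDisjoint (↑(cycles f) : Set (Finset V)) id := by
  intro C hC C' hC' hne
  refine Finset.disjoint_left.2 fun v hv hv' => hne ?_
  exact eq_of_mem_cycles hC hC' hv hv'

theorem eq_of_biUnion_eq {f : V → V} {E E' : Finset (Finset V)} (hE : E ⊆ cycles f)
    (hE' : E' ⊆ cycles f) (hU : E.biUnion id = E'.biUnion id) : E = E' := by
  have key : ∀ {E E' : Finset (Finset V)}, E ⊆ cycles f → E' ⊆ cycles f →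
      E.biUnion id = E'.biUnion id → E ⊆ E' := by
    intro E E' hE hE' hU C hC
    obtain ⟨v, hv⟩ := cycle_nonempty (hE hC)
    have : v ∈ E'.biUnion id := hU ▸ Finset.mem_biUnion.2 ⟨C, hC, hv⟩
    obtain ⟨C', hC', hv'⟩ := Finset.mem_biUnion.1 this
    rwa [eq_of_mem_cycles (hE hC) (hE' hC') hv hv']
  exact (key hE hE' hU).antisymm (key hE' hE hU.symm)

theorem subset_cycleVertices_of_injOn {f : V → V} {W : Finset V} (hmaps : ∀ v ∈ W, f v ∈ W)
    (hinj : Set.InjOn f W) : W ⊆ cycleVertices f := by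
  intro v hv
  have hiter : ∀ k : ℕ, (permOn f W ^ k) v = f^[k] v ∧ f^[k] v ∈ W := by
    intro k
    induction k with
    | zero => exact ⟨rfl, hv⟩
    | succ k ih =>
      rw [pow_succ', Equiv.Perm.mul_apply, ih.1, Function.iterate_succ_apply',
        permOn_apply hmaps hinj, if_pos ih.2]
      exact ⟨rfl, hmaps _ ih.2⟩
  have h1 := (hiter (orderOf (permOn f W))).1
  rw [pow_orderOf_eq_one] at h1
  exact iterate_mem_cycleVertices (i := 0) (orderOf_pos _) h1

/-- A set of vertices which is permuted by `f` is a union of cycles. -/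
theorem biUnion_filter_subset {f : V → V} {W : Finset V} (hmaps : ∀ v ∈ W, f v ∈ W)
    (hinj : Set.InjOn f W) : ((cycles f).filter (fun C => C ⊆ W)).biUnion id = W := by
  have hper := subset_cycleVertices_of_injOn hmaps hinj
  ext v
  rw [Finset.mem_biUnion]
  constructor
  · rintro ⟨C, hC, hv⟩
    exact (Finset.mem_filter.1 hC).2 hv
  · intro hv
    refine ⟨cycleThrough f v, Finset.mem_filter.2
      ⟨Finset.mem_image_of_mem _ (hper hv), fun u hu => ?_⟩,
      (mem_cycleThrough (hper hv)).2 (Reach.refl _ _)⟩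
    exact Finset.mem_coe.1 (((mem_cycleThrough (hper hv)).1 hu).mem_of_closed (K := (W : Set V))
      (by simpa using hmaps) (by simpa using hv))

theorem apply_mem_biUnion {f : V → V} {E : Finset (Finset V)} (hE : E ⊆ cycles f) {v : V}
    (hv : v ∈ E.biUnion id) : f v ∈ E.biUnion id := by
  rw [Finset.mem_biUnion] at hv ⊢
  obtain ⟨C, hC, hv⟩ := hv
  exact ⟨C, hC, mem_cycle_of_reach (hE hC) hv (reach_apply f v)⟩

theorem permOn_biUnion_apply {f : V → V} {E : Finset (Finset V)} (hE : E ⊆ cycles f) (v : V) :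
    permOn f (E.biUnion id) v = if v ∈ E.biUnion id then f v else v := by
  refine permOn_apply (fun v hv => apply_mem_biUnion hE hv) ?_ v
  refine (injOn_cycleVertices f).mono fun v hv => ?_
  obtain ⟨C, hC, hv⟩ := Finset.mem_biUnion.1 (Finset.mem_coe.1 hv)
  exact subset_cycleVertices (hE hC) hv

theorem support_permOn_biUnion {f : V → V} (hf : ∀ v, f v ≠ v) {E : Finset (Finset V)}
    (hE : E ⊆ cycles f) : (permOn f (E.biUnion id)).support = E.biUnion id := by
  ext v
  rw [Equiv.Perm.mem_support, permOn_biUnion_apply hE]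
  split_ifs with h
  · exact ⟨fun _ => h, fun _ => hf v⟩
  · exact ⟨fun h' => (h' rfl).elim, fun h' => (h h').elim⟩

theorem sign_permOn_cycle {f : V → V} (hf : ∀ v, f v ≠ v) {C : Finset V} (hC : C ∈ cycles f) :
    Equiv.Perm.sign (permOn f C) = -(-1) ^ C.card := by
  have hE : ({C} : Finset (Finset V)) ⊆ cycles f := by simpa using hC
  have happ := permOn_biUnion_apply hE
  have hsupp := support_permOn_biUnion hf hE
  rw [Finset.singleton_biUnion, id] at happ hsupp
  have hcyc : (permOn f C).IsCycle := by
    obtain ⟨v, hv⟩ := cycle_nonempty hC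
    refine ⟨v, by rw [happ, if_pos hv]; exact hf v, fun u hu => ?_⟩
    rw [← Equiv.Perm.mem_support, hsupp] at hu
    obtain ⟨k, rfl⟩ := reach_of_mem_cycle hC hv hu
    refine ⟨k, ?_⟩
    clear hu
    rw [zpow_natCast]
    induction k with
    | zero => rfl
    | succ k ih =>
      rw [pow_succ', Equiv.Perm.mul_apply, ih, happ,
        if_pos (mem_cycle_of_reach hC hv (reach_iterate f k v)), Function.iterate_succ_apply']
  rw [hcyc.sign, hsupp]

theorem sign_permOn_biUnion {f : V → V} (hf : ∀ v, f v ≠ v) {E : Finset (Finset V)}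
    (hE : E ⊆ cycles f) :
    Equiv.Perm.sign (permOn f (E.biUnion id)) = ∏ C ∈ E, -(-1) ^ C.card := by
  induction E using Finset.induction_on with
  | empty =>
    have : permOn f ((∅ : Finset (Finset V)).biUnion id) = 1 := by
      ext v
      rw [permOn_biUnion_apply hE]
      simp
    rw [this]
    simp
  | insert C E hCE ih =>
    have hC : C ∈ cycles f := hE (Finset.mem_insert_self _ _)
    have hE' : E ⊆ cycles f := (Finset.subset_insert _ _).trans hE
    have hC1 : ({C} : Finset (Finset V)) ⊆ cycles f := by simpa using hC
    have hmul : permOn f ((insert C E).biUnion id) = permOn f C * permOn f (E.biUnion id) := by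
      have happ := permOn_biUnion_apply hC1
      rw [Finset.singleton_biUnion, id] at happ
      have hdisj : ∀ v ∈ E.biUnion id, v ∉ C := by
        intro v hv hvC
        obtain ⟨C', hC', hv⟩ := Finset.mem_biUnion.1 hv
        exact hCE (eq_of_mem_cycles hC (hE' hC') hvC hv ▸ hC')
      ext v
      rw [Equiv.Perm.mul_apply, permOn_biUnion_apply hE, permOn_biUnion_apply hE', happ]
      have hmem : v ∈ (insert C E).biUnion id ↔ v ∈ C ∨ v ∈ E.biUnion id := by
        rw [Finset.biUnion_insert, Finset.mem_union, id]
      by_cases hv : v ∈ E.biUnion id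
      · rw [if_pos (hmem.2 (Or.inr hv)), if_pos hv, if_neg (hdisj _ (apply_mem_biUnion hE' hv))]
      · rw [if_neg hv, if_congr (hmem.trans (or_iff_left hv)) rfl rfl]
    rw [hmul, Equiv.Perm.sign_mul, ih hE', sign_permOn_cycle hf hC, Finset.prod_insert hCE]

/-- The permutations whose non-trivial cycles are cycles of `f` correspond to the sets of cycles
of `f`. -/
theorem sum_powerset_cycles {f : V → V} (hf : ∀ v, f v ≠ v) (x : V → ℂ) (h : Finset V → ℂ) :
    ∑ E ∈ (cycles f).powerset, (∏ C ∈ E, -(-1) ^ C.card * ∏ v ∈ C, x v) * h (E.biUnion id)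
      = ∑ τ : Equiv.Perm V with ∀ v, τ v ≠ v → τ v = f v,
        ((Equiv.Perm.sign τ : ℤ) : ℂ) * (∏ v ∈ τ.support, x v) * h τ.support := by
  refine Finset.sum_nbij (fun E => permOn f (E.biUnion id)) ?_ ?_ ?_ ?_
  · intro E hE
    rw [Finset.mem_powerset] at hE
    rw [Finset.mem_filter]
    refine ⟨Finset.mem_univ _, fun v => ?_⟩
    rw [permOn_biUnion_apply hE]
    split_ifs <;> simp
  · intro E hE E' hE' heq
    rw [Finset.mem_coe, Finset.mem_powerset] at hE hE'
    have hU : E.biUnion id = E'.biUnion id := by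
      rw [← support_permOn_biUnion hf hE, ← support_permOn_biUnion hf hE']
      exact congrArg _ heq
    exact eq_of_biUnion_eq hE hE' hU
  · intro τ hτ
    simp only [Finset.coe_filter, Finset.mem_univ, true_and, Set.mem_ofPred_eq] at hτ
    have hτs : ∀ v ∈ τ.support, τ v = f v := fun v hv => hτ v (Equiv.Perm.mem_support.1 hv)
    have hmaps : ∀ v ∈ τ.support, f v ∈ τ.support := fun v hv => by
      rw [← hτs v hv]; exact Equiv.Perm.apply_mem_support.2 hv
    have hinj : Set.InjOn f τ.support := fun u hu v hv huv => τ.injective (by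
      rw [hτs u hu, hτs v hv, huv])
    have hU := biUnion_filter_subset hmaps hinj
    refine ⟨(cycles f).filter (fun C => C ⊆ τ.support),
      Finset.mem_coe.2 (Finset.mem_powerset.2 (Finset.filter_subset _ _)), ?_⟩
    ext v
    dsimp only
    rw [permOn_biUnion_apply (Finset.filter_subset _ _), hU]
    split_ifs with hv
    · exact (hτs v hv).symm
    · exact (Equiv.Perm.notMem_support.1 hv).symm
  · intro E hE
    rw [Finset.mem_powerset] at hE
    rw [sign_permOn_biUnion hf hE, support_permOn_biUnion hf hE, Finset.prod_mul_distrib,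
      Finset.prod_biUnion ((pairwiseDisjoint_cycles f).subset (Finset.coe_subset.2 hE))]
    push_cast
    rfl

open Classical in
/-- The determinant as a sum over the configurations together with a set of their cycles, such that
the blocks outside these cycles are even. -/
theorem det_twist_eq_sum_configurations {A : Matrix V V ℂ} (hskew : ∀ i j, A j i = -A i j)
    (hsum : ∀ i, ∑ j, A i j = 0) (ψ : Connection (graphOf A)) :
    (twist A ψ).det = ∑ f : V → V with IsCRSF (graphOf A) f, (∏ v, A v (f v)) *
      ∑ E ∈ (cycles f).powerset, (∏ C ∈ E, -(-1) ^ C.card * monodromy ψ f C) *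
        if EvenBlocks f (E.biUnion id) then 1 else 0 := by
  have hadj : ∑ f : V → V with IsCRSF (graphOf A) f, (∏ v, A v (f v)) *
      ∑ E ∈ (cycles f).powerset, (∏ C ∈ E, -(-1) ^ C.card * monodromy ψ f C) *
        (if EvenBlocks f (E.biUnion id) then (1 : ℂ) else 0)
      = ∑ f : V → V with ∀ v, f (f v) ≠ v, (∏ v, A v (f v)) *
      ∑ E ∈ (cycles f).powerset, (∏ C ∈ E, -(-1) ^ C.card * monodromy ψ f C) *
        (if EvenBlocks f (E.biUnion id) then 1 else 0) := by
    refine Finset.sum_subset (fun f hf => ?_) fun f hf hf' => ?_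
    · rw [Finset.mem_filter] at hf ⊢
      exact ⟨hf.1, hf.2.2⟩
    · rw [Finset.mem_filter] at hf hf'
      have : ∃ v, ¬ (graphOf A).Adj v (f v) := by
        by_contra! h
        exact hf' ⟨hf.1, h, hf.2⟩
      obtain ⟨v, hv⟩ := this
      rw [graphOf_adj hskew, not_not] at hv
      rw [Finset.prod_eq_zero (Finset.mem_univ v) hv, zero_mul]
  rw [hadj, det_twist_eq_sum hskew ψ]
  have hstep : ∀ f ∈ (Finset.univ.filter fun f : V → V => ∀ v, f (f v) ≠ v),
      ((∏ v, A v (f v)) *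
      ∑ E ∈ (cycles f).powerset, (∏ C ∈ E, -(-1) ^ C.card * monodromy ψ f C) *
        (if EvenBlocks f (E.biUnion id) then (1 : ℂ) else 0))
      = ∑ τ : Equiv.Perm V with ∀ v, τ v ≠ v → τ v = f v, (∏ v, A v (f v)) *
        (((Equiv.Perm.sign τ : ℤ) : ℂ) * (∏ v ∈ τ.support, (ψ.transport v (f v) : ℂ)) *
          if EvenBlocks f τ.support then (1 : ℂ) else 0) := by
    intro f hf
    rw [← Finset.mul_sum]
    congr 1
    refine sum_powerset_cycles (fun v hv => (Finset.mem_filter.1 hf).2 v ?_)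
      (fun v => (ψ.transport v (f v) : ℂ)) fun W => if EvenBlocks f W then 1 else 0
    rw [hv, hv]
  rw [Finset.sum_congr rfl hstep]
  rw [Finset.sum_comm' (t' := Finset.univ.filter fun τ : Equiv.Perm V =>
      ∀ v, τ v ≠ v → τ (τ v) ≠ v)
    (s' := fun τ => (extensions τ τ.support).filter fun f => ∀ v, f (f v) ≠ v)]
  · refine Finset.sum_congr rfl fun τ hτ => ?_
    rw [← explorationSum_eq_matchingSum A hskew hsum τ.support τ
      fun v hv => Equiv.Perm.apply_mem_support.2 hv]
    unfold explorationSum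
    rw [Finset.mul_sum]
    have hτ2 := (Finset.mem_filter.1 hτ).2
    rw [Finset.sum_filter]
    refine Finset.sum_congr rfl fun f hf => ?_
    rw [mem_extensions] at hf
    have hiff : IsEvenOutside f τ.support ↔ (∀ v, f (f v) ≠ v) ∧ EvenBlocks f τ.support := by
      refine and_congr_left fun _ => ⟨fun h v => ?_, fun h v _ => h v⟩
      by_cases hv : v ∈ τ.support
      · rw [hf v hv, hf _ (Equiv.Perm.apply_mem_support.2 hv)]
        exact hτ2 v (Equiv.Perm.mem_support.1 hv)
      · exact h v hv
    by_cases h1 : ∀ v, f (f v) ≠ v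
    · by_cases h2 : EvenBlocks f τ.support
      · rw [if_pos h1, if_pos h2, if_pos (hiff.2 ⟨h1, h2⟩),
          ← Finset.prod_mul_prod_compl τ.support]
        have h3 : ∏ v ∈ τ.support, twist A ψ v (τ v)
            = (∏ v ∈ τ.support, A v (f v)) * ∏ v ∈ τ.support, (ψ.transport v (f v) : ℂ) := by
          rw [← Finset.prod_mul_distrib]
          exact Finset.prod_congr rfl fun v hv => by rw [hf v hv]; rfl
        rw [h3]
        ring
      · rw [if_pos h1, if_neg h2, if_neg fun h => h2 (hiff.1 h).2]
        simp
    · rw [if_neg h1, if_neg fun h => h1 (hiff.1 h).1]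
      simp
  · intro f τ
    simp only [Finset.mem_filter, Finset.mem_univ, true_and, mem_extensions,
      Equiv.Perm.mem_support]
    constructor
    · rintro ⟨h1, h2⟩
      refine ⟨⟨fun v hv => (h2 v hv).symm, h1⟩, fun v hv => ?_⟩
      rw [h2 (τ v) (fun e => hv (τ.injective e)), h2 v hv]
      exact h1 v
    · rintro ⟨⟨h1, h2⟩, -⟩
      exact ⟨h2, fun v hv => (h1 v hv).symm⟩

end

/-! ### Reversing cycles -/

section

variable {V : Type*} [Fintype V] [LinearOrder V]

theorem IsCRSF.apply_ne {X : Type*} {G : SimpleGraph X} {f : X → X} (hf : IsCRSF G f) (v : X) :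
    f v ≠ v :=
  (hf.1 v).ne'

theorem eq_or_apply_eq_of_unoriented_eq {f g : V → V} (h : unoriented f = unoriented g) (v : V) :
    g v = f v ∨ f (g v) = v := by
  have h1 : s(v, g v) ∈ unoriented f := h ▸ Finset.mem_image_of_mem _ (Finset.mem_univ v)
  obtain ⟨u, -, hu⟩ := Finset.mem_image.1 h1
  rcases Sym2.eq_iff.1 hu with ⟨rfl, h2⟩ | ⟨rfl, h2⟩
  · exact Or.inl h2.symm
  · exact Or.inr h2

/-- The vertices at which two configurations with the same unoriented edges differ. -/
def diffVertices (f g : V → V) : Finset V := Finset.univ.filter fun v => g v ≠ f v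

theorem mem_diffVertices {f g : V → V} {v : V} : v ∈ diffVertices f g ↔ g v ≠ f v := by
  simp [diffVertices]

theorem diffVertices_comm (f g : V → V) : diffVertices f g = diffVertices g f := by
  ext v; rw [mem_diffVertices, mem_diffVertices, ne_comm]

section SameEdges

variable {G : SimpleGraph V} {f g : V → V} (hf : IsCRSF G f) (hg : IsCRSF G g)
  (h : unoriented f = unoriented g)

include h in
theorem apply_apply_of_mem_diffVertices {v : V} (hv : v ∈ diffVertices f g) : f (g v) = v :=
  (eq_or_apply_eq_of_unoriented_eq h v).resolve_left (mem_diffVertices.1 hv)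

include hf h in
theorem apply_mem_diffVertices {v : V} (hv : v ∈ diffVertices f g) : f v ∈ diffVertices f g := by
  have h1 : g (f v) = v := apply_apply_of_mem_diffVertices h.symm (diffVertices_comm f g ▸ hv)
  rw [mem_diffVertices, h1]
  exact (hf.2 v).symm

include h in
theorem injOn_diffVertices : Set.InjOn f (diffVertices f g) := by
  intro u hu v hv huv
  rw [Finset.mem_coe, diffVertices_comm] at hu hv
  rw [← apply_apply_of_mem_diffVertices h.symm hu, huv,
    apply_apply_of_mem_diffVertices h.symm hv]

include hf hg h in
theorem reach_of_unoriented_eq (v : V) : Reach f v (g v) := by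
  by_cases hv : v ∈ diffVertices f g
  · have h1 : g v ∈ diffVertices f g := by
      rw [diffVertices_comm] at hv ⊢
      exact apply_mem_diffVertices hg h.symm hv
    have h2 := subset_cycleVertices_of_injOn (fun v hv => apply_mem_diffVertices hf h hv)
      (injOn_diffVertices h) h1
    exact Reach.symm_of_mem_cycleVertices ⟨1, apply_apply_of_mem_diffVertices h hv⟩ h2
  · rw [mem_diffVertices, not_not] at hv
    exact ⟨1, hv.symm⟩

include hf hg h in
/-- Reversing cycles does not change reachability. -/
theorem reach_iff_of_unoriented_eq (u v : V) : Reach f u v ↔ Reach g u v := by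
  have key : ∀ {f g : V → V}, (∀ v, Reach f v (g v)) → ∀ u v, Reach g u v → Reach f u v := by
    rintro f g H u _ ⟨k, rfl⟩
    induction k with
    | zero => exact Reach.refl _ _
    | succ k ih => rw [Function.iterate_succ_apply']; exact ih.trans (H _)
  exact ⟨key (reach_of_unoriented_eq hg hf h.symm) u v, key (reach_of_unoriented_eq hf hg h) u v⟩

theorem mem_cycleVertices_iff_exists {X : Type*} [Fintype X] {f : X → X} (hne : ∀ v, f v ≠ v)
    {v : X} :
    v ∈ cycleVertices f ↔ ∃ u ≠ v, Reach f v u ∧ Reach f u v := by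
  rw [mem_cycleVertices]
  constructor
  · exact fun hv => ⟨f v, hne v, reach_apply f v, hv⟩
  · rintro ⟨u, hu, ⟨k, rfl⟩, huv⟩
    cases k with
    | zero => exact (hu rfl).elim
    | succ k =>
      rw [Function.iterate_succ_apply] at huv
      exact (reach_iterate f k (f v)).trans huv

include hf hg h in
theorem cycleVertices_eq_of_unoriented_eq : cycleVertices f = cycleVertices g := by
  ext v
  rw [mem_cycleVertices_iff_exists hf.apply_ne, mem_cycleVertices_iff_exists hg.apply_ne]
  simp only [reach_iff_of_unoriented_eq hf hg h]

include hf hg h in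
theorem cycles_eq_of_unoriented_eq : cycles f = cycles g := by
  have hc := cycleVertices_eq_of_unoriented_eq hf hg h
  rw [cycles, cycles, ← hc]
  refine Finset.image_congr fun v hv => ?_
  ext u
  rw [mem_cycleThrough hv, mem_cycleThrough (hc ▸ hv), reach_iff_of_unoriented_eq hf hg h]

include hf hg h in
theorem evenBlocks_iff_of_unoriented_eq (W : Finset V) : EvenBlocks f W ↔ EvenBlocks g W := by
  have h1 : ∀ r, block f W r = block g W r := fun r => by
    ext v
    rw [mem_block, mem_block, minSource_congr (reach_iff_of_unoriented_eq hf hg h)]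
  simp only [EvenBlocks, h1]

end SameEdges

/-- The configuration obtained from `f` by reversing the cycles in `D`. -/
noncomputable def reverseCycles (f : V → V) (D : Finset (Finset V)) (v : V) : V :=
  if v ∈ D.biUnion id then (permOn f (D.biUnion id))⁻¹ v else f v

section reverseCycles

variable {G : SimpleGraph V} {f : V → V} {D : Finset (Finset V)}

theorem reverseCycles_of_notMem {v : V} (hv : v ∉ D.biUnion id) : reverseCycles f D v = f v :=
  if_neg hv

theorem reverseCycles_spec (hD : D ⊆ cycles f) {v : V} (hv : v ∈ D.biUnion id) :
    reverseCycles f D v ∈ D.biUnion id ∧ f (reverseCycles f D v) = v := by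
  rw [reverseCycles, if_pos hv]
  have h1 := permOn_biUnion_apply hD ((permOn f (D.biUnion id))⁻¹ v)
  rw [show permOn f (D.biUnion id) ((permOn f (D.biUnion id))⁻¹ v) = v by simp] at h1
  split_ifs at h1 with h2
  · exact ⟨h2, h1.symm⟩
  · exact (h2 (h1 ▸ hv)).elim

theorem injOn_biUnion (hD : D ⊆ cycles f) : Set.InjOn f (D.biUnion id) := by
  refine (injOn_cycleVertices f).mono fun v hv => ?_
  obtain ⟨C, hC, hv⟩ := Finset.mem_biUnion.1 (Finset.mem_coe.1 hv)
  exact subset_cycleVertices (hD hC) hv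

theorem reverseCycles_apply (hD : D ⊆ cycles f) {v : V} (hv : v ∈ D.biUnion id) :
    reverseCycles f D (f v) = v := by
  have h1 := reverseCycles_spec hD (apply_mem_biUnion hD hv)
  exact injOn_biUnion hD h1.1 hv h1.2

theorem unoriented_reverseCycles (hD : D ⊆ cycles f) :
    unoriented (reverseCycles f D) = unoriented f := by
  ext e
  simp only [unoriented, Finset.mem_image, Finset.mem_univ, true_and]
  constructor
  · rintro ⟨v, rfl⟩
    by_cases hv : v ∈ D.biUnion id
    · refine ⟨reverseCycles f D v, ?_⟩
      rw [(reverseCycles_spec hD hv).2, Sym2.eq_swap]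
    · exact ⟨v, by rw [reverseCycles_of_notMem hv]⟩
  · rintro ⟨v, rfl⟩
    by_cases hv : v ∈ D.biUnion id
    · refine ⟨f v, ?_⟩
      rw [reverseCycles_apply hD hv, Sym2.eq_swap]
    · exact ⟨v, by rw [reverseCycles_of_notMem hv]⟩

theorem reverseCycles_ne (hf : IsCRSF G f) (hD : D ⊆ cycles f) {v : V} (hv : v ∈ D.biUnion id) :
    reverseCycles f D v ≠ f v := by
  intro e
  have := (reverseCycles_spec hD hv).2
  rw [e] at this
  exact hf.2 v this

theorem isCRSF_reverseCycles (hf : IsCRSF G f) (hD : D ⊆ cycles f) :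
    IsCRSF G (reverseCycles f D) := by
  constructor
  · intro v
    by_cases hv : v ∈ D.biUnion id
    · have := hf.1 (reverseCycles f D v)
      rw [(reverseCycles_spec hD hv).2] at this
      exact this.symm
    · rw [reverseCycles_of_notMem hv]; exact hf.1 v
  · intro v e
    by_cases hv : v ∈ D.biUnion id
    · have h1 := reverseCycles_spec hD hv
      have h2 := (reverseCycles_spec hD h1.1).2
      rw [e] at h2
      exact reverseCycles_ne hf hD hv h2.symm
    · rw [reverseCycles_of_notMem hv] at e
      by_cases hv' : f v ∈ D.biUnion id
      · exact hv (e ▸ (reverseCycles_spec hD hv').1)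
      · rw [reverseCycles_of_notMem hv'] at e
        exact hf.2 v e

theorem diffVertices_reverseCycles (hf : IsCRSF G f) (hD : D ⊆ cycles f) :
    diffVertices f (reverseCycles f D) = D.biUnion id := by
  ext v
  rw [mem_diffVertices]
  by_cases hv : v ∈ D.biUnion id
  · exact ⟨fun _ => hv, fun _ => reverseCycles_ne hf hD hv⟩
  · rw [reverseCycles_of_notMem hv]
    exact ⟨fun h => (h rfl).elim, fun h => (hv h).elim⟩

open Classical in
/-- The cycle-rooted spanning forests with the same unoriented edges as `f` are obtained by
reversing some of the cycles of `f`. -/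
theorem sum_unoriented_eq (hf : IsCRSF G f) (F : (V → V) → ℂ) :
    ∑ g : V → V with IsCRSF G g ∧ unoriented g = unoriented f, F g
      = ∑ D ∈ (cycles f).powerset, F (reverseCycles f D) := by
  symm
  refine Finset.sum_nbij (reverseCycles f) ?_ ?_ ?_ fun _ _ => rfl
  · intro D hD
    rw [Finset.mem_powerset] at hD
    simp only [Finset.mem_filter, Finset.mem_univ, true_and]
    exact ⟨isCRSF_reverseCycles hf hD, unoriented_reverseCycles hD⟩
  · intro D hD D' hD' e
    rw [Finset.mem_coe, Finset.mem_powerset] at hD hD'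
    refine eq_of_biUnion_eq hD hD' ?_
    rw [← diffVertices_reverseCycles hf hD, ← diffVertices_reverseCycles hf hD', e]
  · intro g hg
    simp only [Finset.coe_filter, Finset.mem_univ, true_and, Set.mem_ofPred_eq] at hg
    obtain ⟨hg, h⟩ := hg
    have hmaps : ∀ v ∈ diffVertices f g, f v ∈ diffVertices f g := fun v hv =>
      apply_mem_diffVertices hf h.symm hv
    have hinj := injOn_diffVertices h.symm
    have hU := biUnion_filter_subset hmaps hinj
    have hD := Finset.filter_subset (fun C => C ⊆ diffVertices f g) (cycles f)
    refine ⟨_, Finset.mem_coe.2 (Finset.mem_powerset.2 hD), ?_⟩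
    funext v
    by_cases hv : v ∈ diffVertices f g
    · have h1 := reverseCycles_spec hD (hU.symm ▸ hv)
      have h2 : g v ∈ diffVertices f g := by
        rw [diffVertices_comm] at hv ⊢
        exact apply_mem_diffVertices hg h hv
      rw [hU] at h1
      exact hinj h1.1 h2 (h1.2.trans (apply_apply_of_mem_diffVertices h.symm hv).symm)
    · rw [reverseCycles_of_notMem (hU.symm ▸ hv)]
      rw [mem_diffVertices, not_not] at hv
      exact hv.symm

theorem prod_reverseCycles_of_mem (hD : D ⊆ cycles f) {C : Finset V} (hC : C ∈ D)
    (x : V → V → ℂ) : ∏ v ∈ C, x v (reverseCycles f D v) = ∏ v ∈ C, x (f v) v := by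
  have hCU : ∀ v ∈ C, v ∈ D.biUnion id := fun v hv => Finset.mem_biUnion.2 ⟨C, hC, hv⟩
  refine Finset.prod_nbij' (reverseCycles f D) f ?_ ?_ ?_ ?_ ?_
  · intro v hv
    have h1 := reverseCycles_spec hD (hCU v hv)
    obtain ⟨C', hC', h2⟩ := Finset.mem_biUnion.1 h1.1
    have h3 := mem_cycle_of_reach (hD hC') h2 (reach_apply f _)
    rw [h1.2] at h3
    rwa [eq_of_mem_cycles (hD hC) (hD hC') hv h3]
  · intro v hv
    exact mem_cycle_of_reach (hD hC) hv (reach_apply f v)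
  · intro v hv
    exact (reverseCycles_spec hD (hCU v hv)).2
  · intro v hv
    exact reverseCycles_apply hD (hCU v hv)
  · intro v hv
    rw [(reverseCycles_spec hD (hCU v hv)).2]

theorem prod_reverseCycles_of_notMem (hD : D ⊆ cycles f) {C : Finset V} (hC : C ∈ cycles f)
    (hCD : C ∉ D) (x : V → V → ℂ) :
    ∏ v ∈ C, x v (reverseCycles f D v) = ∏ v ∈ C, x v (f v) := by
  refine Finset.prod_congr rfl fun v hv => ?_
  rw [reverseCycles_of_notMem]
  intro h
  obtain ⟨C', hC', h2⟩ := Finset.mem_biUnion.1 h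
  exact hCD (eq_of_mem_cycles hC (hD hC') hv h2 ▸ hC')

theorem cycleWeight_reverseCycles {A : Matrix V V ℂ} (hskew : ∀ i j, A j i = -A i j)
    (hD : D ⊆ cycles f) {C : Finset V} (hC : C ∈ cycles f) :
    cycleWeight A (reverseCycles f D) C
      = (if C ∈ D then (-1) ^ C.card else 1) * cycleWeight A f C := by
  unfold cycleWeight
  split_ifs with h
  · rw [prod_reverseCycles_of_mem hD h A, Finset.prod_congr rfl fun v _ => hskew v (f v),
      Finset.prod_neg]
  · rw [prod_reverseCycles_of_notMem hD hC h A, one_mul]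

theorem monodromy_reverseCycles (hf : IsCRSF G f) (ψ : Connection G)
    (hD : D ⊆ cycles f) {C : Finset V} (hC : C ∈ cycles f) :
    monodromy ψ (reverseCycles f D) C
      = if C ∈ D then (monodromy ψ f C)⁻¹ else monodromy ψ f C := by
  unfold monodromy
  split_ifs with h
  · rw [prod_reverseCycles_of_mem hD h fun u v => (ψ.transport u v : ℂ), ← Finset.prod_inv_distrib]
    refine Finset.prod_congr rfl fun v _ => ?_
    rw [ψ.transport_symm _ _ (hf.1 v).symm, Units.val_inv_eq_inv_val]
  · rw [prod_reverseCycles_of_notMem hD hC h fun u v => (ψ.transport u v : ℂ)]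

theorem cycles_biUnion (f : V → V) : (cycles f).biUnion id = cycleVertices f := by
  have := biUnion_filter_subset (fun v hv => apply_mem_cycleVertices hv) (injOn_cycleVertices f)
  rwa [Finset.filter_true_of_mem fun C hC => subset_cycleVertices hC] at this

theorem prod_eq_branchWeight_mul (A : Matrix V V ℂ) (f : V → V) :
    ∏ v, A v (f v) = branchWeight A f * ∏ C ∈ cycles f, cycleWeight A f C := by
  rw [branchWeight, mul_comm, ← Finset.prod_mul_prod_compl (cycleVertices f)]
  congr 1
  conv_lhs => rw [← cycles_biUnion]
  rw [Finset.prod_biUnion (pairwiseDisjoint_cycles f)]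
  rfl

theorem branchWeight_reverseCycles (A : Matrix V V ℂ) (hf : IsCRSF G f) (hD : D ⊆ cycles f) :
    branchWeight A (reverseCycles f D) = branchWeight A f := by
  rw [branchWeight, branchWeight, cycleVertices_eq_of_unoriented_eq (isCRSF_reverseCycles hf hD) hf
    (unoriented_reverseCycles hD)]
  refine Finset.prod_congr rfl fun v hv => ?_
  rw [reverseCycles_of_notMem]
  intro h
  obtain ⟨C, hC, h2⟩ := Finset.mem_biUnion.1 h
  exact Finset.mem_compl.1 hv (subset_cycleVertices (hD hC) h2)

end reverseCycles

/-! ### Summation over the orientations of the cycles -/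

/-- If the cycles which are not in `E` are even, then the blocks outside the cycles in `E` are
even iff the blocks outside all cycles are: a cycle is contained in one block. -/
theorem evenBlocks_biUnion_iff {f : V → V} {E : Finset (Finset V)} (hE : E ⊆ cycles f)
    (hodd : ∀ C ∈ cycles f, C ∉ E → Even C.card) :
    EvenBlocks f (E.biUnion id) ↔ EvenBlocks f (cycleVertices f) := by
  refine forall_congr' fun r => ?_
  set D : Finset (Finset V) := (cycles f \ E).filter fun C => ∀ v ∈ C, minSource f v = r with hDdef
  have hD : D ⊆ cycles f := (Finset.filter_subset _ _).trans Finset.sdiff_subset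
  have hEU : E.biUnion id ⊆ cycleVertices f := fun v hv => by
    obtain ⟨C, hC, hv⟩ := Finset.mem_biUnion.1 hv
    exact subset_cycleVertices (hE hC) hv
  have hunion : block f (E.biUnion id) r = block f (cycleVertices f) r ∪ D.biUnion id := by
    ext v
    rw [Finset.mem_union, mem_block, mem_block]
    constructor
    · rintro ⟨h1, h2⟩
      by_cases hv : v ∈ cycleVertices f
      · right
        rw [← cycles_biUnion] at hv
        obtain ⟨C, hC, hv⟩ := Finset.mem_biUnion.1 hv
        refine Finset.mem_biUnion.2 ⟨C, Finset.mem_filter.2 ⟨Finset.mem_sdiff.2 ⟨hC, fun hCE =>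
          h1 (Finset.mem_biUnion.2 ⟨C, hCE, hv⟩)⟩, fun u hu => ?_⟩, hv⟩
        rw [← h2]
        exact le_antisymm (minSource_anti (reach_of_mem_cycle hC hv hu))
          (minSource_anti (reach_of_mem_cycle hC hu hv))
      · exact Or.inl ⟨hv, h2⟩
    · rintro (⟨h1, h2⟩ | h)
      · exact ⟨fun h => h1 (hEU h), h2⟩
      · obtain ⟨C, hC, hv⟩ := Finset.mem_biUnion.1 h
        obtain ⟨hC', hr⟩ := Finset.mem_filter.1 hC
        refine ⟨fun h' => ?_, hr v hv⟩
        obtain ⟨C', hC'', hv'⟩ := Finset.mem_biUnion.1 h'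
        exact (Finset.mem_sdiff.1 hC').2 (eq_of_mem_cycles (hD hC) (hE hC'') hv hv' ▸ hC'')
  have hdisj : Disjoint (block f (cycleVertices f) r) (D.biUnion id) := by
    refine Finset.disjoint_left.2 fun v hv hv' => (mem_block.1 hv).1 ?_
    obtain ⟨C, hC, hv⟩ := Finset.mem_biUnion.1 hv'
    exact subset_cycleVertices (hD hC) hv
  have heven : Even (D.biUnion id).card := by
    rw [Finset.card_biUnion ((pairwiseDisjoint_cycles f).subset (Finset.coe_subset.2 hD))]
    refine Finset.even_sum _ fun C hC => ?_
    have := Finset.mem_sdiff.1 (Finset.mem_filter.1 hC).1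
    exact hodd C this.1 this.2
  rw [hunion, Finset.card_union_of_disjoint hdisj, Nat.even_add]
  simp [heven]

/-- Summation over the orientations of the cycles, when the cycles of a set `E` carry their
monodromy and their signature: the odd cycles outside `E` cancel. -/
theorem sum_reverseCycles {A : Matrix V V ℂ} (hskew : ∀ i j, A j i = -A i j)
    (ψ : Connection (graphOf A)) {f : V → V} (hf : IsCRSF (graphOf A) f)
    {E : Finset (Finset V)} (hE : E ⊆ cycles f) :
    ∑ D ∈ (cycles f).powerset, (∏ v, A v (reverseCycles f D v)) *
        ∏ C ∈ E, -(-1) ^ C.card * monodromy ψ (reverseCycles f D) C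
      = branchWeight A f *
        ((∏ C ∈ E, cycleWeight A f C *
            -((-1) ^ C.card * monodromy ψ f C + (monodromy ψ f C)⁻¹)) *
          ∏ C ∈ cycles f \ E, cycleWeight A f C * (1 + (-1) ^ C.card)) := by
  have hsign : ∀ C : Finset V, ((-1 : ℂ) ^ C.card) * (-1) ^ C.card = 1 := fun C => by
    rw [← mul_pow]; simp
  have hterm : ∀ D ∈ (cycles f).powerset, (∏ v, A v (reverseCycles f D v)) *
      ∏ C ∈ E, -(-1) ^ C.card * monodromy ψ (reverseCycles f D) C
      = branchWeight A f * ((∏ C ∈ D, cycleWeight A f C *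
            if C ∈ E then -(monodromy ψ f C)⁻¹ else (-1) ^ C.card) *
          ∏ C ∈ cycles f \ D, cycleWeight A f C *
            if C ∈ E then -(-1) ^ C.card * monodromy ψ f C else 1) := by
    intro D hD
    rw [Finset.mem_powerset] at hD
    have hEprod : ∏ C ∈ E, -(-1) ^ C.card * monodromy ψ (reverseCycles f D) C
        = ∏ C ∈ cycles f, if C ∈ E then -(-1) ^ C.card * monodromy ψ (reverseCycles f D) C
          else 1 := by
      rw [Finset.prod_ite_mem, Finset.inter_eq_right.2 hE]
    rw [prod_eq_branchWeight_mul, branchWeight_reverseCycles A hf hD,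
      cycles_eq_of_unoriented_eq (isCRSF_reverseCycles hf hD) hf (unoriented_reverseCycles hD),
      hEprod, mul_assoc, ← Finset.prod_mul_distrib, ← Finset.prod_sdiff hD, mul_comm (∏ C ∈ D, _)]
    congr 2
    · refine Finset.prod_congr rfl fun C hC => ?_
      rw [Finset.mem_sdiff] at hC
      rw [cycleWeight_reverseCycles hskew hD hC.1, monodromy_reverseCycles hf ψ hD hC.1,
        if_neg hC.2, if_neg hC.2, one_mul]
    · refine Finset.prod_congr rfl fun C hC => ?_
      rw [cycleWeight_reverseCycles hskew hD (hD hC), monodromy_reverseCycles hf ψ hD (hD hC),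
        if_pos hC, if_pos hC]
      split_ifs
      · linear_combination -cycleWeight A f C * (monodromy ψ f C)⁻¹ * hsign C
      · ring
  rw [Finset.sum_congr rfl hterm, ← Finset.mul_sum, ← Finset.prod_add, ← Finset.prod_sdiff hE,
    mul_comm (∏ C ∈ E, _)]
  congr 2
  · refine Finset.prod_congr rfl fun C hC => ?_
    rw [if_neg (Finset.mem_sdiff.1 hC).2, if_neg (Finset.mem_sdiff.1 hC).2]
    ring
  · refine Finset.prod_congr rfl fun C hC => ?_
    rw [if_pos hC, if_pos hC]
    ring

/-- The contribution of a cycle-rooted spanning forest `f`, summed over the orientations of its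
cycles. -/
noncomputable def forestWeight (A : Matrix V V ℂ) (ψ : Connection (graphOf A)) (f : V → V) : ℂ :=
  branchWeight A f *
    (∏ C ∈ (cycles f).filter (fun C => Odd C.card),
      cycleWeight A f C * (monodromy ψ f C - (monodromy ψ f C)⁻¹)) *
    (∏ C ∈ (cycles f).filter (fun C => Even C.card),
      cycleWeight A f C * (2 - monodromy ψ f C - (monodromy ψ f C)⁻¹))

theorem forestWeight_eq_sum {A : Matrix V V ℂ} (ψ : Connection (graphOf A)) (f : V → V) :
    forestWeight A ψ f = ∑ E ∈ (cycles f).powerset, branchWeight A f *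
        ((∏ C ∈ E, cycleWeight A f C *
            -((-1) ^ C.card * monodromy ψ f C + (monodromy ψ f C)⁻¹)) *
          ∏ C ∈ cycles f \ E, cycleWeight A f C * (1 + (-1) ^ C.card)) := by
  rw [← Finset.mul_sum, ← Finset.prod_add, forestWeight, mul_assoc,
    ← Finset.prod_filter_mul_prod_filter_not (cycles f) (fun C => Odd C.card)]
  simp only [Nat.not_odd_iff_even]
  congr 2
  · refine Finset.prod_congr rfl fun C hC => ?_
    rw [(Finset.mem_filter.1 hC).2.neg_one_pow]
    ring
  · refine Finset.prod_congr rfl fun C hC => ?_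
    rw [(Finset.mem_filter.1 hC).2.neg_one_pow]
    ring

open Classical in
/-- The part of the expansion of the determinant which corresponds to the configurations with the
same unoriented edges as `f`. -/
theorem sum_fiber_eq {A : Matrix V V ℂ} (hskew : ∀ i j, A j i = -A i j)
    (ψ : Connection (graphOf A)) {f : V → V} (hf : IsCRSF (graphOf A) f) :
    ∑ g : V → V with IsCRSF (graphOf A) g ∧ unoriented g = unoriented f, (∏ v, A v (g v)) *
      ∑ E ∈ (cycles g).powerset, (∏ C ∈ E, -(-1) ^ C.card * monodromy ψ g C) *
        (if EvenBlocks g (E.biUnion id) then 1 else 0)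
      = if ConditionC f then forestWeight A ψ f else 0 := by
  rw [sum_unoriented_eq hf]
  have h1 : ∀ D ∈ (cycles f).powerset, (∏ v, A v (reverseCycles f D v)) *
      ∑ E ∈ (cycles (reverseCycles f D)).powerset,
        (∏ C ∈ E, -(-1) ^ C.card * monodromy ψ (reverseCycles f D) C) *
          (if EvenBlocks (reverseCycles f D) (E.biUnion id) then (1 : ℂ) else 0)
      = ∑ E ∈ (cycles f).powerset, ((∏ v, A v (reverseCycles f D v)) *
        ∏ C ∈ E, -(-1) ^ C.card * monodromy ψ (reverseCycles f D) C) *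
          (if EvenBlocks f (E.biUnion id) then 1 else 0) := by
    intro D hD
    rw [Finset.mem_powerset] at hD
    have hg := isCRSF_reverseCycles hf hD
    have hu := unoriented_reverseCycles hD
    rw [cycles_eq_of_unoriented_eq hg hf hu, Finset.mul_sum]
    refine Finset.sum_congr rfl fun E _ => ?_
    rw [if_congr (evenBlocks_iff_of_unoriented_eq hg hf hu _) rfl rfl, mul_assoc]
  rw [Finset.sum_congr rfl h1, Finset.sum_comm]
  have h2 : ∀ E ∈ (cycles f).powerset, ∑ D ∈ (cycles f).powerset,
      ((∏ v, A v (reverseCycles f D v)) *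
        ∏ C ∈ E, -(-1) ^ C.card * monodromy ψ (reverseCycles f D) C) *
          (if EvenBlocks f (E.biUnion id) then (1 : ℂ) else 0)
      = branchWeight A f *
        ((∏ C ∈ E, cycleWeight A f C *
            -((-1) ^ C.card * monodromy ψ f C + (monodromy ψ f C)⁻¹)) *
          ∏ C ∈ cycles f \ E, cycleWeight A f C * (1 + (-1) ^ C.card)) *
          (if ConditionC f then 1 else 0) := by
    intro E hE
    rw [Finset.mem_powerset] at hE
    rw [← Finset.sum_mul, sum_reverseCycles hskew ψ hf hE]
    by_cases hodd : ∀ C ∈ cycles f, C ∉ E → Even C.card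
    · rw [if_congr ((evenBlocks_biUnion_iff hE hodd).trans (conditionC_iff_evenBlocks f).symm)
        rfl rfl]
    · push Not at hodd
      obtain ⟨C, hC, hCE, hCodd⟩ := hodd
      rw [Finset.prod_eq_zero (Finset.mem_sdiff.2 ⟨hC, hCE⟩)]
      · simp
      · rw [(Nat.not_even_iff_odd.1 hCodd).neg_one_pow]
        ring
  rw [Finset.sum_congr rfl h2, ← Finset.sum_mul, ← forestWeight_eq_sum]
  simp

theorem conditionC_iff_of_unoriented_eq {G : SimpleGraph V} {f g : V → V} (hf : IsCRSF G f)
    (hg : IsCRSF G g) (h : unoriented f = unoriented g) : ConditionC f ↔ ConditionC g := by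
  rw [conditionC_iff_evenBlocks, conditionC_iff_evenBlocks,
    cycleVertices_eq_of_unoriented_eq hf hg h, evenBlocks_iff_of_unoriented_eq hf hg h]

theorem det_twist_eq_sum_forests {A : Matrix V V ℂ} (hskew : ∀ i j, A j i = -A i j)
    (hsum : ∀ i, ∑ j, A i j = 0) (ψ : Connection (graphOf A)) (o : Finset (Sym2 V) → V → V)
    (ho : ∀ H ∈ forestsC (graphOf A), IsCRSF (graphOf A) (o H) ∧ unoriented (o H) = H) :
    (twist A ψ).det = ∑ H ∈ forestsC (graphOf A), forestWeight A ψ (o H) := by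
  classical
  rw [det_twist_eq_sum_configurations hskew hsum ψ]
  rw [← Finset.sum_fiberwise_of_maps_to (t := Finset.image unoriented
    (Finset.univ.filter fun f : V → V => IsCRSF (graphOf A) f)) (g := unoriented)
    fun f hf => Finset.mem_image_of_mem _ hf]
  simp only [Finset.filter_filter]
  symm
  refine Finset.sum_subset_zero_on_sdiff ?_ ?_ ?_
  · intro H hH
    simp only [forestsC, Finset.mem_image, Finset.mem_filter, Finset.mem_univ, true_and] at hH ⊢
    obtain ⟨f, hf, rfl⟩ := hH
    exact ⟨f, hf.1, rfl⟩
  · intro H hH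
    simp only [forestsC, Finset.mem_sdiff, Finset.mem_image, Finset.mem_filter, Finset.mem_univ,
      true_and] at hH
    obtain ⟨⟨f, hf, rfl⟩, hH⟩ := hH
    rw [sum_fiber_eq hskew ψ hf, if_neg fun hC => hH ⟨f, ⟨hf, hC⟩, rfl⟩]
  · intro H hH
    obtain ⟨h1, h2⟩ := ho H hH
    have hC : ConditionC (o H) := by
      simp only [forestsC, Finset.mem_image, Finset.mem_filter, Finset.mem_univ, true_and] at hH
      obtain ⟨f, hf, hfH⟩ := hH
      exact (conditionC_iff_of_unoriented_eq hf.1 h1 (hfH.trans h2.symm)).1 hf.2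
    have := sum_fiber_eq hskew ψ h1
    rw [if_pos hC, h2] at this
    exact this.symm

end

end LineBundle

theorem mainTheorem4 (n : ℕ) (A : Matrix (Fin n) (Fin n) ℂ)
    (hskew : ∀ i j, A j i = -A i j)
    (hsum : ∀ i, ∑ j, A i j = 0)
    (ψ : LineBundle.Connection (LineBundle.graphOf A))
    -- an arbitrary choice of orientation of the cycles of each forest
    (o : Finset (Sym2 (Fin n)) → Fin n → Fin n)
    (ho : ∀ H ∈ LineBundle.forestsC (LineBundle.graphOf A),
      LineBundle.IsCRSF (LineBundle.graphOf A) (o H) ∧ LineBundle.unoriented (o H) = H) :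
    (LineBundle.twist A ψ).det =
      ∑ H ∈ LineBundle.forestsC (LineBundle.graphOf A),
        LineBundle.branchWeight A (o H) *
        (∏ C ∈ (LineBundle.cycles (o H)).filter (fun C => Odd C.card),
          LineBundle.cycleWeight A (o H) C *
            (LineBundle.monodromy ψ (o H) C - (LineBundle.monodromy ψ (o H) C)⁻¹)) *
        (∏ C ∈ (LineBundle.cycles (o H)).filter (fun C => Even C.card),
          LineBundle.cycleWeight A (o H) C *
            (2 - LineBundle.monodromy ψ (o H) C - (LineBundle.monodromy ψ (o H) C)⁻¹)) := by
  exact LineBundle.det_twist_eq_sum_forests hskew hsum ψ o ho
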